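/- Notation. Fix an irrational $k>0$ and real constants $c$ (wave speed), $g$ (gravity) and $\tau$ (surface tension). Let $\mathbb T^2=(\mathbb R/2\pi\mathbb Z)^2$. For $\tilde u:\mathbb T^2\to\mathbb R$ with Fourier coefficients $\hat u_{j_1,j_2}$ put $$H[\tilde u](\alpha_1,\alpha_2)=\sum_{(j_1,j_2)\in\mathbb Z^2}(-i)\,\mathrm{sgn}(j_1+j_2k)\,\hat u_{j_1,j_2}e^{i(j_1\alpha_1+j_2\alpha_2)},\qquad P_0[\tilde u]=\hat u_{0,0},\qquad P=\mathrm{id}-P_0,$$ with $\mathrm{sgn}(0)=0$, and let a subscript $\alpha$ on a function on $\mathbb T^2$ denote $\partial_{\alpha_1}+k\partial_{\alpha_2}$. A function $u:\mathbb R\to\mathbb R$ is quasi-periodic if $u(\alpha)=\tilde u(\alpha,k\alpha)$ for a (then unique) continuous $\tilde u$ on $\mathbb T^2$; then $P_0[u]=P_0[\tilde u]$ and $P[u]=u-P_0[u]$. On the line, $H[u](\alpha)=\frac1\pi\,\mathrm{PV}\!\int_{-\infty}^\infty\frac{u(s)}{\alpha-s}\,ds$. The torus version of the traveling wave equations for $\tilde\eta:\mathbb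 T^2\to\mathbb R$ is $$P\Big[\frac{c^2}{2J}+g\tilde\eta-\tau\kappa\Big]=0,\qquad \xi_\alpha=1+H[\tilde\eta_\alpha],\quad J=\xi_\alpha^2+\tilde\eta_\alpha^2,\quad \kappa=\frac{\xi_\alpha\tilde\eta_{\alpha\alpha}-\tilde\eta_\alpha\xi_{\alpha\alpha}}{J^{3/2}} .$$ The conformal evolution equations for $\zeta=\xi+i\eta$ and $\varphi$, functions of $(\alpha,t)\in\mathbb R^2$ that are smooth in $\alpha$ with $\eta,\varphi$ quasi-periodic in $\alpha$ and $P_0[\varphi]=0$, with a given choice of $C_1=C_1(t)$, require that $J=\xi_\alpha^2+\eta_\alpha^2$ does not vanish and that, for some function $x_0(t)$, $$\xi=\alpha+x_0(t)+H[\eta],\qquad \xi_\alpha=1+H[\eta_\alpha],\qquad \psi=-H[\varphi],\qquad \chi=\frac{\psi_\alpha}{J},\qquad \kappa=\frac{\xi_\alpha\eta_{\alpha\alpha}-\eta_\alpha\xi_{\alpha\alpha}}{J^{3/2}},$$ $$\frac{dx_0}{dt}=P_0\big[\xi_\alpha(-H[\chi]+C_1)+\eta_\alpha\chi\big],\qquad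 \eta_t=-\eta_\alpha H[\chi]-\xi_\alpha\chi+C_1\eta_\alpha,$$ $$\varphi_t=P\Big[\frac{\psi_\alpha^2-\varphi_\alpha^2}{2J}-\varphi_\alpha H[\chi]+C_1\varphi_\alpha-g\eta+\tau\kappa\Big].$$ Theorem. Let $\tilde\eta_0(\alpha_1,\alpha_2)=\sum_{(j_1,j_2)\in\mathbb Z^2}\hat\eta_{j_1,j_2}e^{i(j_1\alpha_1+j_2\alpha_2)}$, where, for some constants $C$ and $\varepsilon>0$ and with $K=\max(k,1)$, $$\hat\eta_{-j_1,-j_2}=\overline{\hat\eta_{j_1,j_2}},\qquad |\hat\eta_{j_1,j_2}|\le Ce^{-3\varepsilon K\max(|j_1|,|j_2|)}\qquad\text{for all }(j_1,j_2)\in\mathbb Z^2,$$ and suppose that $\tilde\eta_0$ solves the torus version of the traveling wave equations. Put $\tilde\xi_0=H[\tilde\eta_0]$, $\tilde\varphi_0=cH[\tilde\eta_0]$ and $$\zeta_0(\alpha;\theta)=\alpha+\tilde\xi_0(\alpha,\theta+k\alpha)+i\,\tilde\eta_0(\alpha,\theta+k\alpha),\qquad \varphi_0(\alpha;\theta)=\tilde\varphi_0(\alpha,\theta+k\alpha).$$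 Suppose that for each $\theta\in[0,2\pi)$ the map $\alpha\mapsto\zeta_0(\alpha;\theta)$ is injective on $\mathbb R$ and $\partial_\alpha\zeta_0(\alpha;\theta)\ne0$ for all $\alpha\in\mathbb R$. Then for each $\theta\in\mathbb R$ the functions $$\zeta(\alpha,t;\theta)=\zeta_0(\alpha;\theta)+ct,\qquad \varphi(\alpha,t;\theta)=\varphi_0(\alpha;\theta)$$ solve the conformal evolution equations with $C_1=c\,P_0[\xi_\alpha/J]$, a constant that depends neither on $t$ nor on $\theta$. -/

import Mathlib

open Filter Topology MeasureTheory
open scoped ContDiff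

noncomputable section

namespace QPWave

/-! ### Functions on the torus

A real function on the torus `𝕋² = (ℝ / 2πℤ)²` is a function `ℝ × ℝ → ℝ` that is `2π`-periodic in
each variable. -/

/-- `U` is `2π`-periodic in each of its two variables. -/
def IsTorusFunction (U : ℝ × ℝ → ℝ) : Prop :=
  (∀ x y, U (x + 2 * Real.pi, y) = U (x, y)) ∧ (∀ x y, U (x, y + 2 * Real.pi) = U (x, y))

/-- The exponential `e^{i (j₁ α₁ + j₂ α₂)}`. -/
def torusExp (j : ℤ × ℤ) (p : ℝ × ℝ) : ℂ :=
  Complex.exp (Complex.I * (((j.1 : ℝ) * p.1 + (j.2 : ℝ) * p.2 : ℝ) : ℂ))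

/-- The Fourier coefficient `Û_j = (2π)⁻² ∫_{𝕋²} U(α) e^{-i ⟨j, α⟩} dα`. -/
def torusCoeff (U : ℝ × ℝ → ℝ) (j : ℤ × ℤ) : ℂ :=
  (1 / (2 * Real.pi : ℂ) ^ 2) *
    ∫ x in (0 : ℝ)..(2 * Real.pi), ∫ y in (0 : ℝ)..(2 * Real.pi),
      (U (x, y) : ℂ) * torusExp (-j) (x, y)

/-- The mean `P₀[U] = (2π)⁻² ∫_{𝕋²} U`. -/
def torusMean (U : ℝ × ℝ → ℝ) : ℝ :=
  (1 / (2 * Real.pi) ^ 2) *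
    ∫ x in (0 : ℝ)..(2 * Real.pi), ∫ y in (0 : ℝ)..(2 * Real.pi), U (x, y)

/-- The torus Hilbert transform
`H[U](α) = ∑_j (-i) sgn(j₁ + j₂ k) Û_j e^{i ⟨j, α⟩}`. It is applied only to real functions with
absolutely summable Fourier coefficients; the sum is then real. -/
def torusHilbert (k : ℝ) (U : ℝ × ℝ → ℝ) (p : ℝ × ℝ) : ℝ :=
  (∑' j : ℤ × ℤ,
    (-Complex.I) * ((SignType.sign ((j.1 : ℝ) + (j.2 : ℝ) * k) : ℝ) : ℂ) *
      torusCoeff U j * torusExp j p).re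

/-- The directional derivative `(∂_{α₁} + k ∂_{α₂}) U`. -/
def torusD (k : ℝ) (U : ℝ × ℝ → ℝ) (p : ℝ × ℝ) : ℝ :=
  lineDeriv ℝ U p (1, k)

/-! ### The torus version of the traveling wave equations -/

/-- `ξ_α = 1 + H[η_α]` on the torus. -/
def torusXiAlpha (k : ℝ) (η : ℝ × ℝ → ℝ) (p : ℝ × ℝ) : ℝ :=
  1 + torusHilbert k (torusD k η) p

/-- `J = ξ_α² + η_α²` on the torus. -/
def torusJ (k : ℝ) (η : ℝ × ℝ → ℝ) (p : ℝ × ℝ) : ℝ :=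
  torusXiAlpha k η p ^ 2 + torusD k η p ^ 2

/-- The curvature `κ = (ξ_α η_αα - η_α ξ_αα) / J^{3/2}` on the torus. -/
def torusKappa (k : ℝ) (η : ℝ × ℝ → ℝ) (p : ℝ × ℝ) : ℝ :=
  (torusXiAlpha k η p * torusD k (torusD k η) p
      - torusD k η p * torusD k (torusXiAlpha k η) p) / torusJ k η p ^ (3 / 2 : ℝ)

/-- The quantity `c² / (2 J) + g η - τ κ` on the torus. -/
def torusBernoulli (k c g τ : ℝ) (η : ℝ × ℝ → ℝ) (p : ℝ × ℝ) : ℝ :=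
  c ^ 2 / (2 * torusJ k η p) + g * η p - τ * torusKappa k η p

/-- The torus version of the traveling wave equations: `P[c² / (2 J) + g η - τ κ] = 0`, where
`P = id - P₀`. -/
def SolvesTorusTraveling (k c g τ : ℝ) (η : ℝ × ℝ → ℝ) : Prop :=
  ∀ p, torusBernoulli k c g τ η p - torusMean (torusBernoulli k c g τ η) = 0

/-! ### Quasi-periodic functions on the line -/

/-- `u` is quasi-periodic, `u(α) = U(α, k α)` with `U` continuous on the torus, and
`P₀[u] = P₀[U] = m`. -/
def HasP0 (k : ℝ) (u : ℝ → ℝ) (m : ℝ) : Prop :=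
  ∃ U : ℝ × ℝ → ℝ, Continuous U ∧ IsTorusFunction U ∧ (∀ α, u α = U (α, k * α)) ∧
    torusMean U = m

/-- `u` is quasi-periodic with wave numbers `(1, k)`. -/
def IsQuasiPeriodic (k : ℝ) (u : ℝ → ℝ) : Prop :=
  ∃ U : ℝ × ℝ → ℝ, Continuous U ∧ IsTorusFunction U ∧ ∀ α, u α = U (α, k * α)

/-- `H[u] = v`, where `H[u](α) = (1/π) PV ∫ u(s) / (α - s) ds`: the principal value, taken both at
`s = α` and at infinity, exists and equals `v(α)` for every `α`. -/
def HasHilbert (u v : ℝ → ℝ) : Prop :=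
  LocallyIntegrable u ∧ ∀ α : ℝ,
    Tendsto (fun q : ℝ × ℝ =>
        (1 / Real.pi) * ∫ s in {s : ℝ | q.1 < |α - s| ∧ |α - s| < q.2}, u s / (α - s))
      ((𝓝[>] (0 : ℝ)) ×ˢ atTop) (𝓝 (v α))

/-- The Hilbert transform is unique. -/
theorem HasHilbert.unique {u v w : ℝ → ℝ} (hv : HasHilbert u v) (hw : HasHilbert u w) : v = w :=
  funext fun α => tendsto_nhds_unique (hv.2 α) (hw.2 α)

theorem IsTorusFunction.add_int {U : ℝ × ℝ → ℝ} (hU : IsTorusFunction U) (m n : ℤ) (x y : ℝ) :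
    U (x + m * (2 * Real.pi), y + n * (2 * Real.pi)) = U (x, y) := by
  have h1 : ∀ y, Function.Periodic (fun x => U (x, y)) (2 * Real.pi) := fun y x => hU.1 x y
  have h2 : ∀ x, Function.Periodic (fun y => U (x, y)) (2 * Real.pi) := fun x y => hU.2 x y
  have e1 := (h1 (y + n * (2 * Real.pi))).int_mul m x
  have e2 := (h2 x).int_mul n y
  exact e1.trans e2

/-- For irrational `k` the torus representative, hence `P₀[u]`, is determined by `u`. -/
theorem HasP0.unique {k : ℝ} (hk : Irrational k) {u : ℝ → ℝ} {m m' : ℝ}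
    (h : HasP0 k u m) (h' : HasP0 k u m') : m = m' := by
  obtain ⟨U, hUc, hU, hu, rfl⟩ := h
  obtain ⟨V, hVc, hV, hv, rfl⟩ := h'
  suffices hUV : U = V by rw [hUV]
  funext ⟨x, y⟩
  have hd : Dense (AddSubgroup.closure {k, 1} : Set ℝ) :=
    dense_addSubgroupClosure_pair_iff.2 (by simpa using hk)
  have hset : ∀ r ∈ (AddSubgroup.closure {k, 1} : Set ℝ),
      U (x, k * x + 2 * Real.pi * r) = V (x, k * x + 2 * Real.pi * r) := by
    intro r hr
    obtain ⟨a, b, rfl⟩ := AddSubgroup.mem_closure_pair.1 hr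
    have eU := hU.add_int (-a) b (x + a * (2 * Real.pi)) (k * (x + a * (2 * Real.pi)))
    have eV := hV.add_int (-a) b (x + a * (2 * Real.pi)) (k * (x + a * (2 * Real.pi)))
    rw [← hu] at eU
    rw [← hv] at eV
    have ex : x + a * (2 * Real.pi) + ((-a : ℤ) : ℝ) * (2 * Real.pi) = x := by push_cast; ring
    have ey : k * (x + a * (2 * Real.pi)) + (b : ℝ) * (2 * Real.pi)
        = k * x + 2 * Real.pi * (a • k + b • (1 : ℝ)) := by
      simp only [zsmul_eq_mul]; ring
    rw [ex, ey] at eU eV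
    rw [eU, eV]
  have hfun := Continuous.ext_on hd
    (f := fun r : ℝ => U (x, k * x + 2 * Real.pi * r))
    (g := fun r : ℝ => V (x, k * x + 2 * Real.pi * r)) (by fun_prop) (by fun_prop) hset
  have := congrFun hfun ((y - k * x) / (2 * Real.pi))
  have hy : k * x + 2 * Real.pi * ((y - k * x) / (2 * Real.pi)) = y := by
    have := Real.pi_pos.ne'
    field_simp
    ring
  simpa only [hy] using this

/-! ### The evolution equations in conformal variables

Functions of the conformal variable `α` and of time `t` are written `u α t`. -/

/-- The derivative `u_α`. -/
def dAlpha (u : ℝ → ℝ → ℝ) (α t : ℝ) : ℝ :=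
  deriv (fun a => u a t) α

/-- `J = ξ_α² + η_α²`. -/
def jac (ξ η : ℝ → ℝ → ℝ) (α t : ℝ) : ℝ :=
  dAlpha ξ α t ^ 2 + dAlpha η α t ^ 2

/-- `χ = ψ_α / J`. -/
def chi (ξ η ψ : ℝ → ℝ → ℝ) (α t : ℝ) : ℝ :=
  dAlpha ψ α t / jac ξ η α t

/-- `κ = (ξ_α η_αα - η_α ξ_αα) / J^{3/2}`. -/
def kappa (ξ η : ℝ → ℝ → ℝ) (α t : ℝ) : ℝ :=
  (dAlpha ξ α t * dAlpha (dAlpha η) α t - dAlpha η α t * dAlpha (dAlpha ξ) α t) /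
    jac ξ η α t ^ (3 / 2 : ℝ)

/-- The argument of `P` in the equation for `φ_t`; `Hχ` stands for `H[χ]`. -/
def phiRhs (g τ : ℝ) (C₁ : ℝ → ℝ) (ξ η φ ψ Hχ : ℝ → ℝ → ℝ) (α t : ℝ) : ℝ :=
  (dAlpha ψ α t ^ 2 - dAlpha φ α t ^ 2) / (2 * jac ξ η α t)
    - dAlpha φ α t * Hχ α t + C₁ t * dAlpha φ α t - g * η α t + τ * kappa ξ η α t

/-- The evolution equations, in terms of `ξ`, `η`, `φ` and the auxiliary functions `x₀(t)`, `ψ`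
and `Hχ = H[χ]`, which they determine. -/
structure ConformalSystem (k g τ : ℝ) (C₁ x₀ : ℝ → ℝ) (ξ η φ ψ Hχ : ℝ → ℝ → ℝ) : Prop where
  smooth_xi : ∀ t, ContDiff ℝ ∞ (fun α => ξ α t)
  smooth_eta : ∀ t, ContDiff ℝ ∞ (fun α => η α t)
  smooth_phi : ∀ t, ContDiff ℝ ∞ (fun α => φ α t)
  smooth_psi : ∀ t, ContDiff ℝ ∞ (fun α => ψ α t)
  jac_ne_zero : ∀ α t, jac ξ η α t ≠ 0
  /-- `η` is quasi-periodic. -/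
  quasi_eta : ∀ t, IsQuasiPeriodic k (fun α => η α t)
  /-- `φ` is quasi-periodic, normalized by `P₀[φ] = 0`. -/
  quasi_phi : ∀ t, HasP0 k (fun α => φ α t) 0
  /-- `ξ = α + x₀(t) + H[η]`. -/
  xi_eq : ∀ t, HasHilbert (fun α => η α t) (fun α => ξ α t - α - x₀ t)
  /-- `ξ_α = 1 + H[η_α]`. -/
  xi_alpha_eq : ∀ t, HasHilbert (fun α => dAlpha η α t) (fun α => dAlpha ξ α t - 1)
  /-- `ψ = -H[φ]`. -/
  psi_eq : ∀ t, HasHilbert (fun α => φ α t) (fun α => -ψ α t)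
  /-- `Hχ = H[χ]`. -/
  hilbert_chi : ∀ t, HasHilbert (fun α => chi ξ η ψ α t) (fun α => Hχ α t)
  /-- `dx₀/dt = P₀[ξ_α V / s_α - η_α U / s_α]`, where `V / s_α = -H[χ] + C₁` and
  `U / s_α = -χ`. -/
  x0_evol : ∀ t, ∃ m, HasP0 k (fun α =>
      dAlpha ξ α t * (-Hχ α t + C₁ t) - dAlpha η α t * (-chi ξ η ψ α t)) m ∧ HasDerivAt x₀ m t
  /-- `η_t = -η_α H[χ] - ξ_α χ + C₁ η_α`. -/
  eta_evol : ∀ α t, HasDerivAt (fun s => η α s)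
      (-dAlpha η α t * Hχ α t - dAlpha ξ α t * chi ξ η ψ α t + C₁ t * dAlpha η α t) t
  /-- `φ_t = P[(ψ_α² - φ_α²) / (2 J) - φ_α H[χ] + C₁ φ_α - g η + τ κ]`, where `P = id - P₀`. -/
  phi_evol : ∀ t, ∃ m, HasP0 k (fun α => phiRhs g τ C₁ ξ η φ ψ Hχ α t) m ∧
      ∀ α, HasDerivAt (fun s => φ α s) (phiRhs g τ C₁ ξ η φ ψ Hχ α t - m) t

/-- The curve `ζ = ξ + i η` and the potential `φ` solve the conformal evolution equations with
the choice `C₁` of the free function of time. -/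
def SolvesConformal (k g τ : ℝ) (C₁ : ℝ → ℝ) (ζ : ℝ → ℝ → ℂ) (φ : ℝ → ℝ → ℝ) : Prop :=
  ∃ (x₀ : ℝ → ℝ) (ψ Hχ : ℝ → ℝ → ℝ),
    ConformalSystem k g τ C₁ x₀ (fun α t => (ζ α t).re) (fun α t => (ζ α t).im) φ ψ Hχ

/-! ### The family of traveling waves -/

/-- `ζ₀(α; θ) = α + ξ̃₀(α, θ + k α) + i η̃₀(α, θ + k α)` with `ξ̃₀ = H[η̃₀]`. -/
def zetaZero (k : ℝ) (η₀ : ℝ × ℝ → ℝ) (θ α : ℝ) : ℂ :=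
  ((α + torusHilbert k η₀ (α, θ + k * α) : ℝ) : ℂ) + Complex.I * (η₀ (α, θ + k * α) : ℂ)

/-- `φ₀(α; θ) = φ̃₀(α, θ + k α)` with `φ̃₀ = c H[η̃₀]`. -/
def phiZero (k c : ℝ) (η₀ : ℝ × ℝ → ℝ) (θ α : ℝ) : ℝ :=
  c * torusHilbert k η₀ (α, θ + k * α)

/-- `ζ(α, t; θ) = ζ₀(α; θ) + c t`. -/
def zetaTrav (k c : ℝ) (η₀ : ℝ × ℝ → ℝ) (θ α t : ℝ) : ℂ :=
  zetaZero k η₀ θ α + ((c * t : ℝ) : ℂ)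

/-- `φ(α, t; θ) = φ₀(α; θ)`. -/
def phiTrav (k c : ℝ) (η₀ : ℝ × ℝ → ℝ) (θ α _t : ℝ) : ℝ :=
  phiZero k c η₀ θ α

end QPWave

end

noncomputable section

namespace QPWave

/-! ### The Dirichlet integral -/

/-! Write `w = ξ_α + i η_α` on the torus. Since `ξ̃ = H[η̃]`, the function `w` carries only
frequencies `j₁ + j₂ k ≤ 0`. The heart of the matter is that `1/w` also has only nonpositive
frequencies. Then `H` acts on `i c / w`, whose real part is `c η_α / J = χ`, as `-1` off the mean.
This gives `H[χ] = c (P₀[ξ_α/J] - ξ_α/J)`, so that `C₁ - H[χ] = c ξ_α / J`. With `x₀ = c t` and `ψ =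
c P[η]`, the rest is algebra: the right side for `η` cancels, the one for `x₀` is the mean of `c
(ξ_α² + η_α²) / J = c`, and the one for `φ` is `P` of `c²/2` minus the Bernoulli quantity, a
constant by the traveling wave equation.

The claim on `1/w` is proved in the Wiener algebra `ℓ¹(ℤ²)`, without conformal mapping. With `f = ξ̃
+ i η̃`, the chords `1 + (f(p + r (1, k)) - f(p)) / r` form a continuous path from `w` at `r = 0` to
`1` at `r = ∞`. Injectivity of the curves (for `r ≠ 0`) and nonvanishing of the tangent (for `r =
0`) say that no chord vanishes on the torus (`TorusRep.eval_chord_ne_zero`). By Wiener's lemma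
(`Wiener.isUnit_of_eval_ne_zero`) the path consists of units. Exponentials are open and closed along
such a path and include a neighbourhood of `1`, so `w = exp y` (`Wiener.hasLog_chord_zero`).
Splitting `y` by the sign of the frequency gives a Wiener–Hopf factorization, which exhibits `1/w`
as a multiple of `exp(-y₋)` (`Wiener.HasLog.exists_inverse`).

The evolution equations use the principal value transform on the line. It agrees with the multiplier
`-i sgn(j₁ + j₂ k)` for every absolutely convergent series (`HasTrigSeries.hasHilbert`), by the
Dirichlet integral and dominated convergence. -/

theorem integral_exp_neg_mul_sin (x R : ℝ) :
    ∫ t in (0 : ℝ)..R, Real.exp (-x * t) * Real.sin t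
      = (1 + x ^ 2)⁻¹ - Real.exp (-R * x) * ((Real.cos R + x * Real.sin R) * (1 + x ^ 2)⁻¹) := by
  have hx : (1 + x ^ 2) ≠ 0 := by positivity
  have hd : ∀ t ∈ Set.uIcc 0 R, HasDerivAt
      (fun t => -(Real.exp (-x * t) * ((Real.cos t + x * Real.sin t) * (1 + x ^ 2)⁻¹)))
      (Real.exp (-x * t) * Real.sin t) t := by
    intro t _
    have h1 : HasDerivAt (fun t => Real.exp (-x * t)) (Real.exp (-x * t) * (-x * 1)) t :=
      ((hasDerivAt_id t).const_mul (-x)).exp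
    have h2 : HasDerivAt (fun t => (Real.cos t + x * Real.sin t) * (1 + x ^ 2)⁻¹)
        ((-Real.sin t + x * Real.cos t) * (1 + x ^ 2)⁻¹) t :=
      ((Real.hasDerivAt_cos t).add ((Real.hasDerivAt_sin t).const_mul x)).mul_const _
    refine (h1.mul h2).neg.congr_deriv ?_
    field_simp
    ring
  rw [intervalIntegral.integral_eq_sub_of_hasDerivAt hd
    (Continuous.intervalIntegrable (by fun_prop) _ _)]
  rw [show -R * x = -x * R by ring]
  simp
  ring

theorem abs_cos_add_mul_sin_le (R x : ℝ) :
    ‖(Real.cos R + x * Real.sin R) * (1 + x ^ 2)⁻¹‖ ≤ 2 := by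
  have hx : 0 < 1 + x ^ 2 := by positivity
  rw [Real.norm_eq_abs, abs_mul, abs_inv, abs_of_pos hx, ← div_eq_mul_inv, div_le_iff₀ hx]
  have h1 := Real.abs_cos_le_one R
  have h2 := Real.abs_sin_le_one R
  have h3 : |Real.cos R + x * Real.sin R| ≤ 1 + |x| := by
    refine (abs_add_le _ _).trans (add_le_add h1 ?_)
    rw [abs_mul]
    exact mul_le_of_le_one_right (abs_nonneg _) h2
  nlinarith [sq_abs x, sq_nonneg (|x| - 1)]

/-- Insert `1/t = ∫ e^{-tx} dx` and apply Fubini. On the bounded interval the double integral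
converges absolutely, because integrating the norm in `x` leaves `|sinc t|`. -/
theorem integral_sinc_eq {R : ℝ} (hR : 0 < R) :
    ∫ t in (0 : ℝ)..R, Real.sinc t = Real.pi / 2 -
      ∫ x in Set.Ioi (0 : ℝ), Real.exp (-R * x) *
        ((Real.cos R + x * Real.sin R) * (1 + x ^ 2)⁻¹) := by
  set μ := volume.restrict (Set.Ioc 0 R)
  set ν := volume.restrict (Set.Ioi (0 : ℝ))
  have hexp : ∀ t : ℝ, 0 < t → ∫ x in Set.Ioi (0 : ℝ), Real.exp (-t * x) = t⁻¹ := by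
    intro t ht
    rw [integral_exp_mul_Ioi (by linarith)]
    simp
  have hI : Integrable (Function.uncurry fun t x : ℝ => Real.exp (-t * x) * Real.sin t)
      (μ.prod ν) := by
    rw [integrable_prod_iff (Continuous.aestronglyMeasurable (by unfold Function.uncurry; fun_prop))]
    constructor
    · refine (ae_restrict_iff' measurableSet_Ioc).2 (ae_of_all _ fun t ht => ?_)
      have hneg : -t < 0 := by linarith [ht.1]
      exact (integrableOn_exp_mul_Ioi hneg 0).mul_const (Real.sin t)
    · refine Integrable.congr (f := fun t => |Real.sinc t|) ?_ ?_
      · exact (Real.continuous_sinc.abs.integrableOn_Ioc)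
      · refine (ae_restrict_iff' measurableSet_Ioc).2 (ae_of_all _ fun t ht => ?_)
        simp only [Function.uncurry, norm_mul, Real.norm_eq_abs, Real.abs_exp]
        rw [integral_mul_const, hexp t ht.1, Real.sinc_of_ne_zero ht.1.ne', abs_div,
          abs_of_pos ht.1]
        ring
  have hswap := integral_integral_swap hI
  have hl : ∫ t, ∫ x, Real.exp (-t * x) * Real.sin t ∂ν ∂μ = ∫ t in (0 : ℝ)..R, Real.sinc t := by
    rw [intervalIntegral.integral_of_le hR.le]
    refine setIntegral_congr_fun measurableSet_Ioc fun t ht => ?_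
    rw [integral_mul_const, hexp t ht.1, Real.sinc_of_ne_zero ht.1.ne']
    ring
  have hr : ∀ x, ∫ t, Real.exp (-t * x) * Real.sin t ∂μ
      = (1 + x ^ 2)⁻¹ - Real.exp (-R * x) * ((Real.cos R + x * Real.sin R) * (1 + x ^ 2)⁻¹) := by
    intro x
    rw [← integral_exp_neg_mul_sin, intervalIntegral.integral_of_le hR.le]
    refine integral_congr_ae (ae_of_all _ fun t => ?_)
    simp only
    rw [show -t * x = -x * t by ring]
  rw [← hl, hswap]
  simp_rw [hr]
  rw [integral_sub, integral_Ioi_inv_one_add_sq, Real.arctan_zero, sub_zero]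
  · exact integrable_inv_one_add_sq.integrableOn
  · refine Integrable.mono' ((integrableOn_exp_mul_Ioi (a := -R) (by linarith) 0).mul_const 2)
      (Continuous.aestronglyMeasurable ?_) (ae_of_all _ fun x => ?_)
    · have : ∀ x : ℝ, 1 + x ^ 2 ≠ 0 := fun x => by positivity
      fun_prop (disch := exact this _)
    · rw [norm_mul, Real.norm_eq_abs, Real.abs_exp]
      refine mul_le_mul_of_nonneg_left ?_ (Real.exp_pos _).le
      exact abs_cos_add_mul_sin_le R x

theorem abs_integral_sinc_sub_le {R : ℝ} (hR : 0 < R) :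
    |(∫ t in (0 : ℝ)..R, Real.sinc t) - Real.pi / 2| ≤ 2 / R := by
  rw [integral_sinc_eq hR, sub_sub_cancel_left, abs_neg, ← Real.norm_eq_abs]
  have hI := (integrableOn_exp_mul_Ioi (a := -R) (by linarith) 0).mul_const 2
  refine (norm_integral_le_of_norm_le hI (ae_of_all _ fun x => ?_)).trans (le_of_eq ?_)
  · rw [norm_mul, Real.norm_eq_abs, Real.abs_exp]
    exact mul_le_mul_of_nonneg_left (abs_cos_add_mul_sin_le R x) (Real.exp_pos _).le
  · rw [integral_mul_const, integral_exp_mul_Ioi (by linarith)]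
    simp
    ring

/-- The sine integral. -/
def sineIntegral (x : ℝ) : ℝ := ∫ t in (0 : ℝ)..x, Real.sinc t

theorem sineIntegral_zero : sineIntegral 0 = 0 := by simp [sineIntegral]

theorem sineIntegral_neg (x : ℝ) : sineIntegral (-x) = -sineIntegral x := by
  have := intervalIntegral.integral_comp_neg (a := 0) (b := x) Real.sinc
  simp only [Real.sinc_neg, neg_zero] at this
  rw [sineIntegral, sineIntegral, this, intervalIntegral.integral_symm]

theorem continuous_sineIntegral : Continuous sineIntegral :=
  intervalIntegral.continuous_primitive
    (fun _ _ => Real.continuous_sinc.intervalIntegrable _ _) 0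

theorem tendsto_sineIntegral_atTop : Tendsto sineIntegral atTop (𝓝 (Real.pi / 2)) := by
  rw [tendsto_iff_norm_sub_tendsto_zero]
  refine squeeze_zero' (g := fun R => 2 / R) (Eventually.of_forall fun _ => norm_nonneg _) ?_
    (tendsto_const_nhds.div_atTop tendsto_id)
  filter_upwards [eventually_gt_atTop 0] with R hR
  exact abs_integral_sinc_sub_le hR

/-- Only uniformity in `x` matters: this is the dominating constant when the cutoffs are removed
under an infinite sum. The value is not sharp. -/
theorem abs_sineIntegral_le (x : ℝ) : |sineIntegral x| ≤ Real.pi / 2 + 2 := by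
  have hpi := Real.pi_pos
  have key : ∀ x : ℝ, 0 ≤ x → |sineIntegral x| ≤ Real.pi / 2 + 2 := by
    intro x hx
    rcases le_total x 1 with h | h
    · have : ‖sineIntegral x‖ ≤ 1 * |x - 0| :=
        intervalIntegral.norm_integral_le_of_norm_le_const fun t _ => Real.abs_sinc_le_one t
      rw [Real.norm_eq_abs, sub_zero, abs_of_nonneg hx] at this
      linarith
    · have h1 := abs_integral_sinc_sub_le (R := x) (by linarith)
      have h2 : 2 / x ≤ 2 := div_le_self (by norm_num) h
      have h3 := abs_le.1 (h1.trans h2)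
      rw [sineIntegral, abs_le]
      constructor <;> linarith [h3.1, h3.2]
  rcases le_total 0 x with h | h
  · exact key x h
  · have := key (-x) (by linarith)
    rwa [sineIntegral_neg, abs_neg] at this

/-- The factor `sgn`, with `sgn 0 = 0`, of the Hilbert multiplier originates here. -/
theorem tendsto_sineIntegral_mul_atTop (l : ℝ) :
    Tendsto (fun R => sineIntegral (l * R)) atTop
      (𝓝 ((SignType.sign l : ℝ) * (Real.pi / 2))) := by
  rcases lt_trichotomy l 0 with h | rfl | h
  · have h1 := tendsto_sineIntegral_atTop.comp
      (tendsto_id.const_mul_atTop (show 0 < -l by linarith))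
    simp only [sign_neg h, SignType.coe_neg_one, neg_one_mul]
    refine h1.neg.congr fun R => ?_
    simp only [Function.comp, id]
    rw [← sineIntegral_neg]
    congr 1
    ring
  · simp [sineIntegral_zero]
  · simp only [sign_pos h, SignType.coe_one, one_mul]
    exact tendsto_sineIntegral_atTop.comp (tendsto_id.const_mul_atTop h)

theorem integral_sin_mul_div {δ R : ℝ} (hδ : 0 < δ) (hR : δ < R) (l : ℝ) :
    ∫ r in δ..R, Real.sin (l * r) / r = sineIntegral (l * R) - sineIntegral (l * δ) := by
  rw [sineIntegral, sineIntegral, intervalIntegral.integral_interval_sub_left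
    (Real.continuous_sinc.intervalIntegrable _ _) (Real.continuous_sinc.intervalIntegrable _ _),
    ← intervalIntegral.mul_integral_comp_mul_left, ← intervalIntegral.integral_const_mul]
  refine intervalIntegral.integral_congr fun r hr => ?_
  rw [Set.uIcc_of_le hR.le] at hr
  have hr0 : r ≠ 0 := by linarith [hr.1]
  rcases eq_or_ne l 0 with rfl | hl
  · simp
  · rw [Real.sinc_of_ne_zero (mul_ne_zero hl hr0)]
    field_simp

/-! ### The Hilbert transform of a trigonometric series -/

/-- Fold the two sides of the singularity together by `s = α ∓ r`. -/
theorem truncated_hilbert_eq {u : ℝ → ℝ} (hu : Continuous u) {δ R : ℝ} (hδ : 0 < δ) (hR : δ < R)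
    (α : ℝ) :
    ∫ s in {s : ℝ | δ < |α - s| ∧ |α - s| < R}, u s / (α - s)
      = ∫ r in δ..R, (u (α - r) - u (α + r)) / r := by
  have hset : {s : ℝ | δ < |α - s| ∧ |α - s| < R}
      = Set.Ioo (α - R) (α - δ) ∪ Set.Ioo (α + δ) (α + R) := by
    ext s
    simp only [Set.mem_ofPred_eq, Set.mem_union, Set.mem_Ioo]
    constructor
    · rintro ⟨h1, h2⟩
      rw [abs_lt] at h2
      rcases lt_abs.1 h1 with h | h
      · left; constructor <;> linarith
      · right; constructor <;> linarith
    · rintro (⟨h1, h2⟩ | ⟨h1, h2⟩)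
      · rw [abs_of_pos (by linarith)]; constructor <;> linarith
      · rw [abs_of_neg (by linarith)]; constructor <;> linarith
  have hc1 : ContinuousOn (fun s => u s / (α - s)) (Set.Icc (α - R) (α - δ)) :=
    hu.continuousOn.div (by fun_prop) fun s hs => by linarith [hs.2]
  have hc2 : ContinuousOn (fun s => u s / (α - s)) (Set.Icc (α + δ) (α + R)) :=
    hu.continuousOn.div (by fun_prop) fun s hs => by
      intro h; linarith [hs.1]
  have hc3 : ContinuousOn (fun r => u (α - r) / r) (Set.uIcc δ R) := by
    rw [Set.uIcc_of_le hR.le]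
    exact (hu.comp (by fun_prop)).continuousOn.div (by fun_prop) fun s hs => by linarith [hs.1]
  have hc4 : ContinuousOn (fun r => u (α + r) / r) (Set.uIcc δ R) := by
    rw [Set.uIcc_of_le hR.le]
    exact (hu.comp (by fun_prop)).continuousOn.div (by fun_prop) fun s hs => by linarith [hs.1]
  rw [hset, setIntegral_union (Set.disjoint_left.2 fun s h1 h2 => by
      linarith [h1.2, h2.1]) measurableSet_Ioo
    (hc1.integrableOn_Icc.mono_set Set.Ioo_subset_Icc_self)
    (hc2.integrableOn_Icc.mono_set Set.Ioo_subset_Icc_self),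
    ← integral_Ioc_eq_integral_Ioo, ← integral_Ioc_eq_integral_Ioo,
    ← intervalIntegral.integral_of_le (by linarith), ← intervalIntegral.integral_of_le (by linarith),
    ← intervalIntegral.integral_comp_sub_left (fun s => u s / (α - s)),
    ← intervalIntegral.integral_comp_add_left (fun s => u s / (α - s))]
  simp only [sub_sub_cancel, sub_add_cancel_left, div_neg, sub_div]
  rw [intervalIntegral.integral_neg, intervalIntegral.integral_sub hc3.intervalIntegrable
    hc4.intervalIntegrable, sub_eq_add_neg]

/-- A continuous function with absolutely convergent trigonometric expansion
`f(α) = ∑ cᵢ e^{i lᵢ α}`. -/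
structure HasTrigSeries {ι : Type*} (c : ι → ℂ) (l : ι → ℝ) (f : ℝ → ℂ) : Prop where
  summable : Summable fun i => ‖c i‖
  hasSum : ∀ α, HasSum (fun i => c i * Complex.exp (Complex.I * ((l i * α : ℝ) : ℂ))) (f α)

theorem norm_exp_I_mul (x : ℝ) : ‖Complex.exp (Complex.I * (x : ℂ))‖ = 1 := by
  rw [mul_comm, Complex.norm_exp_ofReal_mul_I]

theorem HasTrigSeries.continuous {ι : Type*} {c : ι → ℂ} {l : ι → ℝ} {f : ℝ → ℂ}
    (h : HasTrigSeries c l f) : Continuous f := by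
  have : f = fun α => ∑' i, c i * Complex.exp (Complex.I * ((l i * α : ℝ) : ℂ)) :=
    funext fun α => (h.hasSum α).tsum_eq.symm
  rw [this]
  refine continuous_tsum (fun i => by fun_prop) h.summable fun i α => ?_
  rw [norm_mul, norm_exp_I_mul, mul_one]

/-- Each exponential contributes `-2i sin(l r)/r`. For fixed cutoffs the sum and the integral
commute, since `1/r ≤ 1/δ`. -/
theorem HasTrigSeries.hasSum_truncated {ι : Type*} [Countable ι] {c : ι → ℂ} {l : ι → ℝ}
    {f : ℝ → ℂ} (h : HasTrigSeries c l f) {δ R : ℝ} (hδ : 0 < δ) (hR : δ < R) (α : ℝ) :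
    HasSum (fun i => c i * Complex.exp (Complex.I * ((l i * α : ℝ) : ℂ)) * (-2 * Complex.I) *
        ((sineIntegral (l i * R) - sineIntegral (l i * δ) : ℝ) : ℂ))
      (∫ r in δ..R, (f (α - r) - f (α + r)) / (r : ℂ)) := by
  have hterm : ∀ i, ∀ r : ℝ, (c i * Complex.exp (Complex.I * ((l i * (α - r) : ℝ) : ℂ)) -
        c i * Complex.exp (Complex.I * ((l i * (α + r) : ℝ) : ℂ))) / (r : ℂ)
      = c i * Complex.exp (Complex.I * ((l i * α : ℝ) : ℂ)) * (-2 * Complex.I) *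
        ((Real.sin (l i * r) / r : ℝ) : ℂ) := by
    intro i r
    push_cast
    rw [Complex.sin, show Complex.I * (l i * (α - r) : ℂ)
      = Complex.I * (l i * α) + -(l i * r) * Complex.I by ring,
      show Complex.I * (l i * (α + r) : ℂ)
      = Complex.I * (l i * α) + (l i * r) * Complex.I by ring, Complex.exp_add, Complex.exp_add]
    linear_combination (c i * Complex.exp (Complex.I * (l i * α)) *
      (Complex.exp (-(l i * r) * Complex.I) - Complex.exp (l i * r * Complex.I)) / r)
        * Complex.I_sq
  have hint : ∀ i, ∫ r in δ..R, (c i * Complex.exp (Complex.I * ((l i * (α - r) : ℝ) : ℂ)) -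
        c i * Complex.exp (Complex.I * ((l i * (α + r) : ℝ) : ℂ))) / (r : ℂ)
      = c i * Complex.exp (Complex.I * ((l i * α : ℝ) : ℂ)) * (-2 * Complex.I) *
        ((sineIntegral (l i * R) - sineIntegral (l i * δ) : ℝ) : ℂ) := by
    intro i
    simp_rw [hterm]
    rw [intervalIntegral.integral_const_mul, intervalIntegral.integral_ofReal,
      integral_sin_mul_div hδ hR]
  simp_rw [← hint]
  refine intervalIntegral.hasSum_integral_of_dominated_convergence (fun i _ => ‖c i‖ * (2 / δ))
    (fun i => ?_) (fun i => ?_) ?_ ?_ ?_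
  · exact Measurable.aestronglyMeasurable (by fun_prop)
  · refine ae_of_all _ fun r hr => ?_
    rw [Set.uIoc_of_le hR.le] at hr
    have hr0 : 0 < r := hδ.trans hr.1
    rw [← mul_sub, norm_div, norm_mul, Complex.norm_real, Real.norm_eq_abs, abs_of_pos hr0,
      mul_div_assoc]
    refine mul_le_mul_of_nonneg_left ?_ (norm_nonneg _)
    refine div_le_div₀ (by norm_num) ((norm_sub_le _ _).trans ?_) hδ hr.1.le
    rw [norm_exp_I_mul, norm_exp_I_mul]
    norm_num
  · exact ae_of_all _ fun r _ => h.summable.mul_right _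
  · exact intervalIntegrable_const
  · exact ae_of_all _ fun r _ => ((h.hasSum _).sub (h.hasSum _)).div_const _

/-- The truncated multipliers are bounded uniformly in the frequency and both cutoffs, and they tend
to `-iπ sgn l`. Absolute summability of the coefficients therefore suffices, even though the
frequencies may accumulate at zero. -/
theorem HasTrigSeries.hasHilbert {ι : Type*} [Countable ι] {c : ι → ℂ} {l : ι → ℝ}
    {f g : ℝ → ℂ} (hf : HasTrigSeries c l f)
    (hg : HasTrigSeries (fun i => (-Complex.I) * ((SignType.sign (l i) : ℝ) : ℂ) * c i) l g) :
    HasHilbert (fun α => (f α).re) (fun α => (g α).re) := by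
  have hcont : Continuous fun α => (f α).re := Complex.continuous_re.comp hf.continuous
  refine ⟨hcont.locallyIntegrable, fun α => ?_⟩
  have hfst : Tendsto (fun q : ℝ × ℝ => q.1) ((𝓝[>] (0 : ℝ)) ×ˢ atTop) (𝓝[>] (0 : ℝ)) :=
    tendsto_fst
  have hsnd : Tendsto (fun q : ℝ × ℝ => q.2) ((𝓝[>] (0 : ℝ)) ×ˢ (atTop : Filter ℝ)) atTop :=
    tendsto_snd
  have hpos : ∀ᶠ q : ℝ × ℝ in (𝓝[>] (0 : ℝ)) ×ˢ atTop, 0 < q.1 ∧ q.1 < q.2 := by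
    filter_upwards [hfst.eventually (Ioo_mem_nhdsGT one_pos),
      hsnd.eventually (eventually_gt_atTop 1)] with q h1 h2
    exact ⟨h1.1, h1.2.trans h2⟩
  have hlim : Tendsto (fun q : ℝ × ℝ => ∑' i,
      c i * Complex.exp (Complex.I * ((l i * α : ℝ) : ℂ)) * (-2 * Complex.I) *
        ((sineIntegral (l i * q.2) - sineIntegral (l i * q.1) : ℝ) : ℂ))
      ((𝓝[>] (0 : ℝ)) ×ˢ atTop)
      (𝓝 (∑' i, c i * Complex.exp (Complex.I * ((l i * α : ℝ) : ℂ)) * (-2 * Complex.I) *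
        (((SignType.sign (l i) : ℝ) * (Real.pi / 2) - 0 : ℝ) : ℂ))) := by
    refine tendsto_tsum_of_dominated_convergence
      (hf.summable.mul_right (2 * (2 * (Real.pi / 2 + 2)))) (fun i => ?_)
      (Eventually.of_forall fun q i => ?_)
    · refine Tendsto.const_mul _ ((Complex.continuous_ofReal.tendsto _).comp (Tendsto.sub
        ((tendsto_sineIntegral_mul_atTop (l i)).comp hsnd) ?_))
      have h0 : Tendsto (fun x => sineIntegral (l i * x)) (𝓝 0) (𝓝 0) := by
        have := (continuous_sineIntegral.comp (continuous_const_mul (l i))).tendsto 0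
        simpa [sineIntegral_zero] using! this
      exact (h0.mono_left nhdsWithin_le_nhds).comp hfst
    · rw [norm_mul, norm_mul, norm_mul, norm_exp_I_mul, mul_one, Complex.norm_real, mul_assoc]
      refine mul_le_mul_of_nonneg_left ?_ (norm_nonneg _)
      refine mul_le_mul (by simp) ?_ (norm_nonneg _) (by norm_num)
      refine (norm_sub_le _ _).trans ?_
      rw [two_mul]
      exact add_le_add (abs_sineIntegral_le _) (abs_sineIntegral_le _)
  have hval : ∑' i, c i * Complex.exp (Complex.I * ((l i * α : ℝ) : ℂ)) * (-2 * Complex.I) *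
        (((SignType.sign (l i) : ℝ) * (Real.pi / 2) - 0 : ℝ) : ℂ) = Real.pi * g α := by
    rw [← (hg.hasSum α).tsum_eq, ← tsum_mul_left]
    refine tsum_congr fun i => ?_
    push_cast
    ring
  rw [hval] at hlim
  have hre := ((Complex.continuous_re.tendsto _).comp hlim).const_mul (1 / Real.pi)
  rw [Complex.re_ofReal_mul, ← mul_assoc, one_div_mul_cancel Real.pi_ne_zero, one_mul] at hre
  refine hre.congr' ?_
  filter_upwards [hpos] with q hq
  rw [truncated_hilbert_eq hcont hq.1 hq.2]
  congr 1
  simp only [Function.comp]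
  rw [(hf.hasSum_truncated hq.1 hq.2 α).tsum_eq]
  have hfc := hf.continuous
  have hii : IntervalIntegrable (fun r : ℝ => (f (α - r) - f (α + r)) / (r : ℂ)) volume q.1 q.2 := by
    refine ContinuousOn.intervalIntegrable ?_
    rw [Set.uIcc_of_le hq.2.le]
    refine ContinuousOn.div (by fun_prop) (by fun_prop) fun r hr => ?_
    exact Complex.ofReal_ne_zero.2 (by linarith [hr.1, hq.1])
  have := Complex.reCLM.intervalIntegral_comp_comm hii
  simp only [Complex.reCLM_apply] at this
  rw [← this]
  refine intervalIntegral.integral_congr fun r _ => ?_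
  rw [Complex.div_ofReal_re, Complex.sub_re]

/-! ### Characters of the torus -/

theorem torusExp_add (i j : ℤ × ℤ) (p : ℝ × ℝ) :
    torusExp (i + j) p = torusExp i p * torusExp j p := by
  rw [torusExp, torusExp, torusExp, ← Complex.exp_add]
  congr 1
  push_cast [Prod.fst_add, Prod.snd_add]
  ring

theorem torusExp_zero (p : ℝ × ℝ) : torusExp 0 p = 1 := by simp [torusExp]

theorem norm_torusExp (j : ℤ × ℤ) (p : ℝ × ℝ) : ‖torusExp j p‖ = 1 := norm_exp_I_mul _

theorem continuous_torusExp (j : ℤ × ℤ) : Continuous (torusExp j) := by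
  unfold torusExp
  fun_prop

theorem torusExp_mk (j : ℤ × ℤ) (x y : ℝ) : torusExp j (x, y)
    = Complex.exp ((j.1 : ℂ) * Complex.I * x) * Complex.exp ((j.2 : ℂ) * Complex.I * y) := by
  rw [torusExp, ← Complex.exp_add]
  congr 1
  push_cast
  ring

theorem exp_int_mul_I_mul_two_pi (n : ℤ) :
    Complex.exp ((n : ℂ) * Complex.I * ((2 * Real.pi : ℝ) : ℂ)) = 1 := by
  rw [Complex.exp_eq_one_iff]
  exact ⟨n, by push_cast; ring⟩

theorem torusExp_add_two_pi_fst (j : ℤ × ℤ) (x y : ℝ) :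
    torusExp j (x + 2 * Real.pi, y) = torusExp j (x, y) := by
  rw [torusExp_mk, torusExp_mk, Complex.ofReal_add, mul_add, Complex.exp_add,
    exp_int_mul_I_mul_two_pi, mul_one]

theorem torusExp_add_two_pi_snd (j : ℤ × ℤ) (x y : ℝ) :
    torusExp j (x, y + 2 * Real.pi) = torusExp j (x, y) := by
  rw [torusExp_mk, torusExp_mk, Complex.ofReal_add, mul_add, Complex.exp_add,
    exp_int_mul_I_mul_two_pi, mul_one]

theorem integral_exp_int_mul_I (n : ℤ) :
    ∫ x in (0 : ℝ)..(2 * Real.pi), Complex.exp ((n : ℂ) * Complex.I * x)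
      = if n = 0 then 2 * (Real.pi : ℂ) else 0 := by
  split_ifs with h
  · subst h
    simp
  · rw [integral_exp_mul_complex (mul_ne_zero (Int.cast_ne_zero.2 h) Complex.I_ne_zero),
      exp_int_mul_I_mul_two_pi]
    simp

theorem integral_torusExp (j : ℤ × ℤ) :
    ∫ x in (0 : ℝ)..(2 * Real.pi), ∫ y in (0 : ℝ)..(2 * Real.pi), torusExp j (x, y)
      = if j = 0 then (2 * (Real.pi : ℂ)) ^ 2 else 0 := by
  simp_rw [torusExp_mk, intervalIntegral.integral_const_mul, intervalIntegral.integral_mul_const,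
    integral_exp_int_mul_I]
  rcases j with ⟨m, n⟩
  by_cases hm : m = 0 <;> by_cases hn : n = 0 <;> simp [hm, hn, sq]

/-! ### Absolutely convergent Fourier series on the torus -/

/-- A function on the torus with absolutely convergent Fourier series `∑ⱼ bⱼ e^{i ⟨j, α⟩}`. -/
structure HasTorusSeries (b : ℤ × ℤ → ℂ) (f : ℝ × ℝ → ℂ) : Prop where
  summable : Summable fun j => ‖b j‖
  hasSum : ∀ p, HasSum (fun j => b j * torusExp j p) (f p)

theorem HasTorusSeries.tsum {b : ℤ × ℤ → ℂ} (hb : Summable fun j => ‖b j‖) :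
    HasTorusSeries b fun p => ∑' j, b j * torusExp j p :=
  ⟨hb, fun p => Summable.hasSum (Summable.of_norm (by simpa [norm_torusExp] using hb))⟩

theorem HasTorusSeries.eq_tsum {b : ℤ × ℤ → ℂ} {f : ℝ × ℝ → ℂ} (h : HasTorusSeries b f) :
    f = fun p => ∑' j, b j * torusExp j p :=
  funext fun p => (h.hasSum p).tsum_eq.symm

theorem HasTorusSeries.continuous {b : ℤ × ℤ → ℂ} {f : ℝ × ℝ → ℂ} (h : HasTorusSeries b f) :
    Continuous f := by
  rw [h.eq_tsum]
  refine continuous_tsum (fun j => (continuous_torusExp j).const_mul _) h.summable fun j p => ?_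
  rw [norm_mul, norm_torusExp, mul_one]

theorem HasTorusSeries.add_two_pi_fst {b : ℤ × ℤ → ℂ} {f : ℝ × ℝ → ℂ} (h : HasTorusSeries b f)
    (x y : ℝ) : f (x + 2 * Real.pi, y) = f (x, y) := by
  simp_rw [h.eq_tsum, torusExp_add_two_pi_fst]

theorem HasTorusSeries.add_two_pi_snd {b : ℤ × ℤ → ℂ} {f : ℝ × ℝ → ℂ} (h : HasTorusSeries b f)
    (x y : ℝ) : f (x, y + 2 * Real.pi) = f (x, y) := by
  simp_rw [h.eq_tsum, torusExp_add_two_pi_snd]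

/-- Shifting the index reduces every Fourier coefficient to the zeroth one. -/
theorem HasTorusSeries.mul_torusExp {b : ℤ × ℤ → ℂ} {f : ℝ × ℝ → ℂ} (h : HasTorusSeries b f)
    (i : ℤ × ℤ) : HasTorusSeries (fun j => b (j - i)) (fun p => f p * torusExp i p) := by
  refine ⟨(Equiv.subRight i).summable_iff.2 h.summable, fun p => ?_⟩
  refine (Equiv.addRight i).hasSum_iff.1 ?_
  have := (h.hasSum p).mul_right (torusExp i p)
  refine this.congr_fun fun j => ?_
  simp [torusExp_add, mul_assoc]

theorem HasTorusSeries.integral_eq {b : ℤ × ℤ → ℂ} {f : ℝ × ℝ → ℂ} (h : HasTorusSeries b f) :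
    ∫ x in (0 : ℝ)..(2 * Real.pi), ∫ y in (0 : ℝ)..(2 * Real.pi), f (x, y)
      = (2 * (Real.pi : ℂ)) ^ 2 * b 0 := by
  have hc : ∀ j, Continuous (torusExp j) := continuous_torusExp
  have hinner : ∀ x : ℝ, HasSum
      (fun j => ∫ y in (0 : ℝ)..(2 * Real.pi), b j * torusExp j (x, y))
      (∫ y in (0 : ℝ)..(2 * Real.pi), f (x, y)) := by
    intro x
    refine intervalIntegral.hasSum_integral_of_dominated_convergence (fun j _ => ‖b j‖)
      (fun j => ?_) (fun j => ?_) ?_ ?_ ?_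
    · exact (((hc j).comp (by fun_prop : Continuous fun y : ℝ => (x, y))).const_mul
        (b j)).aestronglyMeasurable
    · exact ae_of_all _ fun y _ => by rw [norm_mul, norm_torusExp, mul_one]
    · exact ae_of_all _ fun _ _ => h.summable
    · exact intervalIntegrable_const
    · exact ae_of_all _ fun y _ => h.hasSum _
  have houter : HasSum
      (fun j => ∫ x in (0 : ℝ)..(2 * Real.pi), ∫ y in (0 : ℝ)..(2 * Real.pi),
        b j * torusExp j (x, y))
      (∫ x in (0 : ℝ)..(2 * Real.pi), ∫ y in (0 : ℝ)..(2 * Real.pi), f (x, y)) := by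
    refine intervalIntegral.hasSum_integral_of_dominated_convergence
      (fun j _ => ‖b j‖ * |2 * Real.pi - 0|) (fun j => ?_) (fun j => ?_) ?_ ?_ ?_
    · refine Continuous.aestronglyMeasurable ?_
      refine intervalIntegral.continuous_parametric_intervalIntegral_of_continuous' ?_ _ _
      exact (hc j).const_mul _
    · refine ae_of_all _ fun x _ => intervalIntegral.norm_integral_le_of_norm_le_const fun y _ => ?_
      rw [norm_mul, norm_torusExp, mul_one]
    · exact ae_of_all _ fun _ _ => h.summable.mul_right _
    · exact intervalIntegrable_const
    · exact ae_of_all _ fun x _ => hinner x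
  simp_rw [intervalIntegral.integral_const_mul, integral_torusExp] at houter
  rw [houter.unique (hasSum_single 0 fun j hj => by rw [if_neg hj, mul_zero]), if_pos rfl,
    mul_comm]

/-- The coefficients of an absolutely convergent Fourier series are the Fourier coefficients of
its sum. -/
theorem HasTorusSeries.fourier_integral {b : ℤ × ℤ → ℂ} {f : ℝ × ℝ → ℂ} (h : HasTorusSeries b f)
    (j : ℤ × ℤ) :
    (1 / (2 * Real.pi : ℂ) ^ 2) * ∫ x in (0 : ℝ)..(2 * Real.pi), ∫ y in (0 : ℝ)..(2 * Real.pi),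
      f (x, y) * torusExp (-j) (x, y) = b j := by
  rw [(h.mul_torusExp (-j)).integral_eq, ← mul_assoc, one_div_mul_cancel, one_mul, sub_neg_eq_add,
    zero_add]
  exact pow_ne_zero 2 (mul_ne_zero two_ne_zero (Complex.ofReal_ne_zero.2 Real.pi_ne_zero))

theorem HasTorusSeries.unique {b c : ℤ × ℤ → ℂ} {f : ℝ × ℝ → ℂ} (hb : HasTorusSeries b f)
    (hc : HasTorusSeries c f) : b = c :=
  funext fun j => (hb.fourier_integral j).symm.trans (hc.fourier_integral j)

/-! ### The Wiener algebra of the torus -/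

/-- The Wiener algebra `ℓ¹(ℤ²)`, with convolution as its product. -/
def Wiener : Type := lp (fun _ : ℤ × ℤ => ℂ) 1

namespace Wiener

instance : NormedAddCommGroup Wiener :=
  inferInstanceAs (NormedAddCommGroup (lp (fun _ : ℤ × ℤ => ℂ) 1))

instance : NormedSpace ℂ Wiener :=
  inferInstanceAs (NormedSpace ℂ (lp (fun _ : ℤ × ℤ => ℂ) 1))

instance : CompleteSpace Wiener :=
  inferInstanceAs (CompleteSpace (lp (fun _ : ℤ × ℤ => ℂ) 1))

/-- The coefficients of an element of the Wiener algebra. -/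
def coeff (x : Wiener) (j : ℤ × ℤ) : ℂ := x.1 j

@[ext] theorem ext {x y : Wiener} (h : ∀ j, x.coeff j = y.coeff j) : x = y :=
  Subtype.ext (funext h)

@[simp] theorem coeff_add (x y : Wiener) (j : ℤ × ℤ) :
    (x + y).coeff j = x.coeff j + y.coeff j := rfl

@[simp] theorem coeff_sub (x y : Wiener) (j : ℤ × ℤ) :
    (x - y).coeff j = x.coeff j - y.coeff j := rfl

@[simp] theorem coeff_zero (j : ℤ × ℤ) : (0 : Wiener).coeff j = 0 := rfl

@[simp] theorem coeff_smul (z : ℂ) (x : Wiener) (j : ℤ × ℤ) :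
    (z • x).coeff j = z * x.coeff j := rfl

theorem summable (x : Wiener) : Summable fun j => ‖x.coeff j‖ :=
  x.2.summable_of_one.norm

theorem norm_eq (x : Wiener) : ‖x‖ = ∑' j, ‖x.coeff j‖ := by
  have := lp.norm_eq_tsum_rpow (p := 1) (by simp) (show lp (fun _ : ℤ × ℤ => ℂ) 1 from x)
  simp only [ENNReal.toReal_one, Real.rpow_one, div_one] at this
  exact this

theorem norm_coeff_le (x : Wiener) (j : ℤ × ℤ) : ‖x.coeff j‖ ≤ ‖x‖ :=
  lp.norm_apply_le_norm one_ne_zero (show lp (fun _ : ℤ × ℤ => ℂ) 1 from x) j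

/-- The element of the Wiener algebra with given summable coefficients. -/
def ofSummable (b : ℤ × ℤ → ℂ) (hb : Summable fun j => ‖b j‖) : Wiener :=
  ⟨b, memℓp_gen (by simpa using hb)⟩

@[simp] theorem coeff_ofSummable (b : ℤ × ℤ → ℂ) (hb : Summable fun j => ‖b j‖) (j : ℤ × ℤ) :
    (ofSummable b hb).coeff j = b j := rfl

/-- The value at a point of the torus. -/
def eval (p : ℝ × ℝ) (x : Wiener) : ℂ := ∑' j, x.coeff j * torusExp j p

theorem hasTorusSeries (x : Wiener) : HasTorusSeries x.coeff fun p => eval p x :=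
  HasTorusSeries.tsum x.summable

/-- Fourier coefficients are recovered from values, so identities in the algebra, the ring axioms
included, may be checked pointwise in `ℂ`. -/
theorem ext_eval {x y : Wiener} (h : ∀ p, eval p x = eval p y) : x = y := by
  have hx := x.hasTorusSeries
  simp_rw [h] at hx
  exact ext (congrFun (hx.unique y.hasTorusSeries))

theorem eval_add (p : ℝ × ℝ) (x y : Wiener) : eval p (x + y) = eval p x + eval p y := by
  rw [eval, ← (((x.hasTorusSeries.hasSum p).add (y.hasTorusSeries.hasSum p))).tsum_eq]
  exact tsum_congr fun j => by rw [coeff_add, add_mul]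

theorem eval_smul (p : ℝ × ℝ) (z : ℂ) (x : Wiener) : eval p (z • x) = z * eval p x := by
  rw [eval, eval, ← tsum_mul_left]
  exact tsum_congr fun j => by rw [coeff_smul, mul_assoc]

/-- The reindexing `(n, m) ↦ (m, n - m)` of pairs. -/
def convEquiv : (ℤ × ℤ) × (ℤ × ℤ) ≃ (ℤ × ℤ) × (ℤ × ℤ) where
  toFun q := (q.2, q.1 - q.2)
  invFun q := (q.1 + q.2, q.1)
  left_inv q := by simp
  right_inv q := by simp

theorem summable_conv_norm (x y : Wiener) :
    Summable fun q : (ℤ × ℤ) × (ℤ × ℤ) => ‖x.coeff q.2‖ * ‖y.coeff (q.1 - q.2)‖ := by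
  have h : Summable fun q : (ℤ × ℤ) × (ℤ × ℤ) => ‖x.coeff q.1‖ * ‖y.coeff q.2‖ :=
    x.summable.mul_of_nonneg y.summable (fun _ => norm_nonneg _) fun _ => norm_nonneg _
  exact convEquiv.summable_iff.2 h

/-- Convolution of coefficients. -/
def conv (x y : Wiener) (n : ℤ × ℤ) : ℂ := ∑' m, x.coeff m * y.coeff (n - m)

theorem norm_conv_le (x y : Wiener) (n : ℤ × ℤ) :
    ‖conv x y n‖ ≤ ∑' m, ‖x.coeff m‖ * ‖y.coeff (n - m)‖ := by
  have h := (summable_conv_norm x y).prod_factor n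
  simp_rw [← norm_mul] at h ⊢
  exact norm_tsum_le_tsum_norm h

theorem summable_conv (x y : Wiener) : Summable fun n => ‖conv x y n‖ :=
  (summable_conv_norm x y).prod.of_nonneg_of_le (fun _ => norm_nonneg _) (norm_conv_le x y)

instance : Mul Wiener := ⟨fun x y => ofSummable (conv x y) (summable_conv x y)⟩

theorem coeff_mul (x y : Wiener) (n : ℤ × ℤ) :
    (x * y).coeff n = ∑' m, x.coeff m * y.coeff (n - m) := rfl

theorem eval_mul (p : ℝ × ℝ) (x y : Wiener) : eval p (x * y) = eval p x * eval p y := by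
  have hx : Summable fun j => ‖x.coeff j * torusExp j p‖ := by
    simpa [norm_torusExp] using x.summable
  have hy : Summable fun j => ‖y.coeff j * torusExp j p‖ := by
    simpa [norm_torusExp] using y.summable
  have hs := (summable_mul_of_summable_norm hx hy)
  rw [eval, eval, eval, tsum_mul_tsum_of_summable_norm hx hy, ← convEquiv.tsum_eq]
  refine Eq.trans ?_ (convEquiv.summable_iff.2 hs).tsum_prod.symm
  refine tsum_congr fun n => ?_
  rw [coeff_mul, ← tsum_mul_right]
  refine tsum_congr fun m => ?_
  simp only [convEquiv, Equiv.coe_fn_mk, Function.comp]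
  rw [show torusExp n p = torusExp m p * torusExp (n - m) p by
    rw [← torusExp_add, add_sub_cancel]]
  ring

theorem norm_mul_le' (x y : Wiener) : ‖x * y‖ ≤ ‖x‖ * ‖y‖ := by
  rw [norm_eq, norm_eq, norm_eq, x.summable.tsum_mul_tsum y.summable
    (x.summable.mul_of_nonneg y.summable (fun _ => norm_nonneg _) fun _ => norm_nonneg _),
    ← convEquiv.tsum_eq]
  refine le_of_le_of_eq ?_ (Summable.tsum_prod (summable_conv_norm x y)).symm
  exact (summable_conv x y).tsum_le_tsum (norm_conv_le x y) (summable_conv_norm x y).prod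

/-- The monomial `e^{i ⟨j, α⟩}`. -/
def monomial (j : ℤ × ℤ) : Wiener :=
  lp.single 1 j (1 : ℂ)

theorem coeff_monomial (i j : ℤ × ℤ) : (monomial i).coeff j = if j = i then 1 else 0 := by
  by_cases h : j = i
  · subst h
    rw [if_pos rfl]
    exact lp.single_apply_self (E := fun _ : ℤ × ℤ => ℂ) 1 j 1
  · rw [if_neg h]
    exact lp.single_apply_ne (E := fun _ : ℤ × ℤ => ℂ) 1 i 1 h

theorem norm_monomial (j : ℤ × ℤ) : ‖monomial j‖ = 1 := by
  exact (lp.norm_single (E := fun _ : ℤ × ℤ => ℂ) (p := 1) one_pos j 1).trans norm_one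

theorem eval_monomial (p : ℝ × ℝ) (j : ℤ × ℤ) : eval p (monomial j) = torusExp j p := by
  rw [eval, tsum_eq_single j fun i hi => by rw [coeff_monomial, if_neg hi, zero_mul],
    coeff_monomial, if_pos rfl, one_mul]

instance : One Wiener := ⟨monomial 0⟩

theorem coeff_one (j : ℤ × ℤ) : (1 : Wiener).coeff j = if j = 0 then 1 else 0 :=
  coeff_monomial 0 j

theorem eval_one (p : ℝ × ℝ) : eval p 1 = 1 := (eval_monomial p 0).trans (torusExp_zero p)

theorem eval_zero (p : ℝ × ℝ) : eval p 0 = 0 := by simp [eval]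

instance : CommRing Wiener :=
  { (inferInstance : AddCommGroup Wiener) with
    mul := (· * ·)
    one := 1
    left_distrib := fun x y z => ext_eval fun p => by simp only [eval_mul, eval_add, mul_add]
    right_distrib := fun x y z => ext_eval fun p => by simp only [eval_mul, eval_add, add_mul]
    zero_mul := fun x => ext_eval fun p => by simp only [eval_mul, eval_zero, zero_mul]
    mul_zero := fun x => ext_eval fun p => by simp only [eval_mul, eval_zero, mul_zero]
    mul_assoc := fun x y z => ext_eval fun p => by simp only [eval_mul, mul_assoc]
    one_mul := fun x => ext_eval fun p => by simp only [eval_mul, eval_one, one_mul]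
    mul_one := fun x => ext_eval fun p => by simp only [eval_mul, eval_one, mul_one]
    mul_comm := fun x y => ext_eval fun p => by simp only [eval_mul, mul_comm] }

instance : NormedCommRing Wiener :=
  { (inferInstance : NormedAddCommGroup Wiener), (inferInstance : CommRing Wiener) with
    norm_mul_le := norm_mul_le' }

instance : NormedAlgebra ℂ Wiener :=
  { Algebra.ofModule
      (fun z x y => ext_eval fun p => by simp only [eval_mul, eval_smul, mul_assoc])
      (fun z x y => ext_eval fun p => by simp only [eval_mul, eval_smul, mul_left_comm]) with
    norm_smul_le := norm_smul_le }

instance : NormOneClass Wiener := ⟨norm_monomial 0⟩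

theorem monomial_mul (i j : ℤ × ℤ) : monomial i * monomial j = monomial (i + j) :=
  ext_eval fun p => by simp only [eval_mul, eval_monomial, torusExp_add]

theorem hasSum_monomial (x : Wiener) : HasSum (fun j => x.coeff j • monomial j) x := by
  have h := lp.hasSum_single (E := fun _ : ℤ × ℤ => ℂ) ENNReal.one_ne_top
    (show lp (fun _ : ℤ × ℤ => ℂ) 1 from x)
  refine HasSum.congr_fun h fun j => ?_
  have := lp.single_smul (E := fun _ : ℤ × ℤ => ℂ) (p := 1) j (x.coeff j) (1 : ℂ)
  rw [smul_eq_mul, mul_one] at this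
  exact this.symm

end Wiener

namespace Wiener

/-! ### Units -/

/-- Characters are contractive, and a monomial and its inverse both have norm one. -/
theorem norm_character_monomial (f : WeakDual.characterSpace ℂ Wiener) (j : ℤ × ℤ) :
    ‖f (monomial j)‖ = 1 := by
  have hle : ∀ i, ‖f (monomial i)‖ ≤ 1 := fun i =>
    (spectrum.norm_le_norm_of_mem (AlgHom.apply_mem_spectrum f (monomial i))).trans_eq
      (norm_monomial i)
  have hmul : ‖f (monomial j)‖ * ‖f (monomial (-j))‖ = 1 := by
    rw [← norm_mul, ← map_mul, monomial_mul, add_neg_cancel]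
    change ‖f 1‖ = 1
    rw [map_one, norm_one]
  refine le_antisymm (hle j) ?_
  rw [← hmul]
  exact mul_le_of_le_one_right (norm_nonneg _) (hle _)

theorem character_monomial_zsmul (f : WeakDual.characterSpace ℂ Wiener) {j : ℤ × ℤ} {t : ℝ}
    (h : f (monomial j) = Complex.exp (t * Complex.I)) (n : ℤ) :
    f (monomial (n • j)) = Complex.exp ((n : ℂ) * Complex.I * t) := by
  induction n with
  | zero =>
    rw [zero_smul]
    change f 1 = _
    simp
  | succ n ih =>
    rw [add_smul, one_smul, ← monomial_mul, map_mul, ih, h, ← Complex.exp_add]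
    congr 1
    push_cast
    ring
  | pred n ih =>
    have h1 : f (monomial ((-(n : ℤ) - 1) • j)) * f (monomial j) = f (monomial (-(n : ℤ) • j)) := by
      rw [← map_mul, monomial_mul, sub_smul, one_smul, sub_add_cancel]
    refine mul_right_cancel₀ (b := f (monomial j)) (by rw [h]; exact Complex.exp_ne_zero _) ?_
    rw [h1, ih, h, ← Complex.exp_add]
    congr 1
    push_cast
    ring

/-- The characters of the Wiener algebra are the evaluations at the points of the torus. -/
theorem exists_eval_of_character (f : WeakDual.characterSpace ℂ Wiener) :
    ∃ p, ∀ x, f x = eval p x := by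
  obtain ⟨s, hs⟩ := (Complex.norm_eq_one_iff _).1 (norm_character_monomial f (1, 0))
  obtain ⟨t, ht⟩ := (Complex.norm_eq_one_iff _).1 (norm_character_monomial f (0, 1))
  refine ⟨(s, t), fun x => ?_⟩
  have hmon : ∀ j : ℤ × ℤ, f (monomial j) = torusExp j (s, t) := by
    rintro ⟨m, n⟩
    have hj : ((m, n) : ℤ × ℤ) = m • (1, 0) + n • (0, 1) := by ext <;> simp
    rw [torusExp_mk, hj, ← monomial_mul, map_mul, character_monomial_zsmul f hs.symm,
      character_monomial_zsmul f ht.symm]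
    simp
  -- By continuity the values on monomials determine the character through the `ℓ¹` expansion.
  have hsum := x.hasSum_monomial.map f (map_continuous f)
  rw [← hsum.tsum_eq]
  refine tsum_congr fun j => ?_
  rw [Function.comp, map_smul, hmon, smul_eq_mul]

/-- Wiener's lemma. -/
theorem isUnit_of_eval_ne_zero {x : Wiener} (hx : ∀ p, eval p x ≠ 0) : IsUnit x := by
  by_contra h
  -- Gelfand theory: some character kills a nonunit, and that character is a point evaluation.
  obtain ⟨f, hf⟩ := WeakDual.CharacterSpace.exists_apply_eq_zero h
  obtain ⟨p, hp⟩ := exists_eval_of_character f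
  exact hx p ((hp x).symm.trans hf)

/-! ### Exponentials -/

/-- `x` is the exponential of an element of the Wiener algebra. -/
def HasLog (x : Wiener) : Prop := ∃ y, NormedSpace.exp y = x

instance : NormedAlgebra ℚ Wiener := NormedAlgebra.restrictScalars ℚ ℂ Wiener

theorem exp_add (x y : Wiener) :
    NormedSpace.exp (x + y) = NormedSpace.exp x * NormedSpace.exp y :=
  NormedSpace.exp_add

theorem exp_mul_exp_neg (x : Wiener) : NormedSpace.exp x * NormedSpace.exp (-x) = 1 := by
  rw [← exp_add, add_neg_cancel, NormedSpace.exp_zero]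

theorem HasLog.mul {x y : Wiener} (hx : HasLog x) (hy : HasLog y) : HasLog (x * y) := by
  obtain ⟨a, rfl⟩ := hx
  obtain ⟨b, rfl⟩ := hy
  exact ⟨a + b, exp_add a b⟩

theorem HasLog.of_mul_left {x y : Wiener} (hx : HasLog x) (hxy : HasLog (x * y)) : HasLog y := by
  obtain ⟨a, rfl⟩ := hx
  have h : HasLog (NormedSpace.exp (-a) * (NormedSpace.exp a * y)) := HasLog.mul ⟨-a, rfl⟩ hxy
  rwa [← mul_assoc, mul_comm (NormedSpace.exp (-a)), exp_mul_exp_neg, one_mul] at h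

/-- The derivative of `exp` at `0` is the identity, so the inverse function theorem makes `exp` map
neighbourhoods of `0` onto neighbourhoods of `1`. -/
theorem eventually_hasLog : ∀ᶠ x in 𝓝 (1 : Wiener), HasLog x := by
  have h : HasStrictFDerivAt (NormedSpace.exp : Wiener → Wiener)
      ((ContinuousLinearEquiv.refl ℂ Wiener : Wiener ≃L[ℂ] Wiener) : Wiener →L[ℂ] Wiener) 0 :=
    hasStrictFDerivAt_exp_zero
  have hm := h.map_nhds_eq_of_equiv
  rw [NormedSpace.exp_zero] at hm
  rw [← hm, eventually_map]
  exact Eventually.of_forall fun x => ⟨x, rfl⟩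

/-- Along a continuous path of units, having a logarithm does not change. -/
theorem hasLog_of_path {G : ℝ → Wiener} (hG : Continuous G) (hu : ∀ r, IsUnit (G r)) {r s : ℝ}
    (hr : HasLog (G r)) : HasLog (G s) := by
  have hloc : IsLocallyConstant fun r => HasLog (G r) := by
    rw [IsLocallyConstant.iff_eventually_eq]
    intro t
    obtain ⟨u, hut⟩ := hu t
    -- Near `t` the quotient `G r / G t` is close to `1`, hence an exponential, so `G r` and `G t`
    -- have logarithms together or not at all.
    have hc : Tendsto (fun r => (↑u⁻¹ : Wiener) * G r) (𝓝 t) (𝓝 1) := by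
      have : Tendsto (fun r => (↑u⁻¹ : Wiener) * G r) (𝓝 t) (𝓝 ((↑u⁻¹ : Wiener) * G t)) :=
        (continuous_const.mul hG).tendsto t
      rwa [← hut, Units.inv_mul] at this
    filter_upwards [hc.eventually eventually_hasLog] with r hr
    have hGr : G r = (↑u⁻¹ : Wiener) * G r * G t := by
      rw [mul_right_comm, ← hut, Units.inv_mul, one_mul]
    refine propext ⟨fun h => ?_, fun h => ?_⟩
    · rw [hGr] at h
      exact hr.of_mul_left h
    · rw [hGr]
      exact hr.mul h
  exact (hloc.apply_eq_of_preconnectedSpace r s).mp hr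

/-! ### Supports -/

/-- The elements of the Wiener algebra with frequencies in a submonoid. -/
def supported (S : AddSubmonoid (ℤ × ℤ)) : Subalgebra ℂ Wiener where
  carrier := {x | ∀ j ∉ S, x.coeff j = 0}
  mul_mem' := by
    intro x y hx hy n hn
    rw [coeff_mul]
    refine (tsum_congr fun m => ?_).trans tsum_zero
    by_cases hm : m ∈ S
    · rw [hy (n - m) fun h => hn (by simpa using S.add_mem hm h), mul_zero]
    · rw [hx m hm, zero_mul]
  add_mem' := by
    intro x y hx hy n hn
    rw [coeff_add, hx n hn, hy n hn, add_zero]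
  algebraMap_mem' := by
    intro z j hj
    have hj0 : j ≠ 0 := fun h => hj (h ▸ S.zero_mem)
    rw [Algebra.algebraMap_eq_smul_one, coeff_smul, coeff_one, if_neg hj0, mul_zero]

theorem mem_supported {S : AddSubmonoid (ℤ × ℤ)} {x : Wiener} :
    x ∈ supported S ↔ ∀ j ∉ S, x.coeff j = 0 := Iff.rfl

theorem continuous_coeff (j : ℤ × ℤ) : Continuous fun x : Wiener => x.coeff j := by
  refine (LipschitzWith.of_dist_le_mul (K := 1) fun x y => ?_).continuous
  rw [dist_eq_norm, dist_eq_norm, NNReal.coe_one, one_mul, ← coeff_sub]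
  exact norm_coeff_le _ j

theorem isClosed_supported (S : AddSubmonoid (ℤ × ℤ)) :
    IsClosed (supported S : Set Wiener) := by
  have : (supported S : Set Wiener) = ⋂ j ∈ {j | j ∉ S}, {x : Wiener | x.coeff j = 0} := by
    ext x
    simp [mem_supported]
  rw [this]
  exact isClosed_biInter fun j _ => isClosed_eq (continuous_coeff j) continuous_const

/-- The exponential series stays in a closed subalgebra. -/
theorem exp_mem_supported {S : AddSubmonoid (ℤ × ℤ)} {x : Wiener} (hx : x ∈ supported S) :
    NormedSpace.exp x ∈ supported S := by
  rw [NormedSpace.exp_eq_tsum ℂ]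
  exact tsum_mem (isClosed_supported S) fun n => (supported S).smul_mem (pow_mem hx n) _

/-- The part of `x` with frequencies in a given set. -/
def restrict (s : Set (ℤ × ℤ)) (x : Wiener) : Wiener :=
  ofSummable (s.indicator x.coeff)
    (x.summable.of_nonneg_of_le (fun _ => norm_nonneg _) fun _ => norm_indicator_le_norm_self _ _)

theorem restrict_add_restrict_compl (s : Set (ℤ × ℤ)) (x : Wiener) :
    restrict s x + restrict sᶜ x = x :=
  ext fun j => by
    rw [coeff_add]
    exact congrFun (Set.indicator_self_add_compl s x.coeff) j

end Wiener

/-! ### Frequencies and Wiener–Hopf factorization -/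

/-- The frequency `j₁ + j₂ k`. -/
def freq (k : ℝ) : ℤ × ℤ →+ ℝ where
  toFun j := j.1 + j.2 * k
  map_zero' := by simp
  map_add' i j := by push_cast [Prod.fst_add, Prod.snd_add]; ring

theorem freq_apply (k : ℝ) (j : ℤ × ℤ) : freq k j = j.1 + j.2 * k := rfl

/-- The proof uses the irrationality of `k` only through this: zero frequency belongs to the
constants alone. -/
theorem freq_eq_zero {k : ℝ} (hk : Irrational k) {j : ℤ × ℤ} : freq k j = 0 ↔ j = 0 := by
  refine ⟨fun h => ?_, fun h => by rw [h, map_zero]⟩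
  rw [freq_apply] at h
  have h2 : j.2 = 0 := by
    by_contra h2
    exact (hk.intCast_mul h2).ne_int (-j.1) (by push_cast; linarith)
  rw [h2, Int.cast_zero, zero_mul, add_zero, Int.cast_eq_zero] at h
  exact Prod.ext h h2

/-- The lattice points with nonpositive frequency. -/
def nonposFreq (k : ℝ) : AddSubmonoid (ℤ × ℤ) :=
  (AddSubmonoid.mk ⟨Set.Iic 0, fun ha hb => add_nonpos ha hb⟩ le_rfl).comap (freq k)

/-- The lattice points with nonnegative frequency. -/
def nonnegFreq (k : ℝ) : AddSubmonoid (ℤ × ℤ) :=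
  (AddSubmonoid.nonneg ℝ).comap (freq k)

theorem mem_nonposFreq {k : ℝ} {j : ℤ × ℤ} : j ∈ nonposFreq k ↔ freq k j ≤ 0 := Iff.rfl

namespace Wiener

/-- Wiener–Hopf factorization: an exponential with nonpositive frequencies has an inverse with
nonpositive frequencies. -/
theorem HasLog.exists_inverse {k : ℝ} (hk : Irrational k) {x : Wiener} (hlog : HasLog x)
    (hx : x ∈ supported (nonposFreq k)) : ∃ d ∈ supported (nonposFreq k), x * d = 1 := by
  obtain ⟨y, rfl⟩ := hlog
  set s : Set (ℤ × ℤ) := {j | freq k j ≤ 0}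
  have hm : restrict s y ∈ supported (nonposFreq k) := fun j hj =>
    Set.indicator_of_notMem hj _
  have hp : restrict sᶜ y ∈ supported (nonnegFreq k) := fun j hj => by
    refine Set.indicator_of_notMem (fun h => hj ?_) _
    exact (not_le.1 (mt mem_nonposFreq.2 h)).le
  set E := NormedSpace.exp (-restrict s y)
  have hE : E ∈ supported (nonposFreq k) := exp_mem_supported (neg_mem hm)
  have heq : NormedSpace.exp y * E = NormedSpace.exp (restrict sᶜ y) := by
    rw [← exp_add]
    congr 1
    nth_rewrite 1 [← restrict_add_restrict_compl s y]
    abel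
  -- As a product, `exp y · exp(-y₋)` has frequencies `≤ 0`. As `exp(y₊)` it has frequencies `≥ 0`.
  -- Hence it is constant.
  have hneg : NormedSpace.exp y * E ∈ supported (nonposFreq k) := mul_mem hx hE
  have hpos : NormedSpace.exp y * E ∈ supported (nonnegFreq k) := by
    rw [heq]
    exact exp_mem_supported hp
  set z := (NormedSpace.exp y * E).coeff 0 with hz
  have hconst : NormedSpace.exp y * E = z • (1 : Wiener) := by
    ext j
    rw [coeff_smul, coeff_one]
    by_cases hj : j = 0
    · rw [if_pos hj, mul_one, hj]
    · rw [if_neg hj, mul_zero]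
      by_cases h : freq k j ≤ 0
      · exact hpos j fun h' => hj ((freq_eq_zero hk).1 (le_antisymm h h'))
      · exact hneg j h
  -- The constant equals the unit `exp(y₊)`, so it cannot vanish.
  have hz0 : z ≠ 0 := by
    intro h
    have h1 := exp_mul_exp_neg (restrict sᶜ y)
    rw [← heq, hconst, h, zero_smul, zero_mul] at h1
    exact absurd (congrArg norm h1) (by rw [norm_zero, norm_one]; exact zero_ne_one)
  refine ⟨z⁻¹ • E, (supported _).smul_mem hE _, ?_⟩
  rw [mul_smul_comm, hconst, smul_smul, inv_mul_cancel₀ hz0, one_smul]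

end Wiener

/-! ### Means of absolutely convergent Fourier series -/

theorem HasTorusSeries.isTorusFunction_re {b : ℤ × ℤ → ℂ} {f : ℝ × ℝ → ℂ}
    (h : HasTorusSeries b f) : IsTorusFunction fun p => (f p).re :=
  ⟨fun x y => congrArg Complex.re (h.add_two_pi_fst x y),
    fun x y => congrArg Complex.re (h.add_two_pi_snd x y)⟩

theorem HasTorusSeries.torusMean_re {b : ℤ × ℤ → ℂ} {f : ℝ × ℝ → ℂ} (h : HasTorusSeries b f) :
    torusMean (fun p => (f p).re) = (b 0).re := by
  have hc := h.continuous
  have hinner : ∀ x : ℝ, ∫ y in (0 : ℝ)..(2 * Real.pi), (f (x, y)).re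
      = (∫ y in (0 : ℝ)..(2 * Real.pi), f (x, y)).re := fun x =>
    Complex.reCLM.intervalIntegral_comp_comm
      (Continuous.intervalIntegrable (by fun_prop : Continuous fun y : ℝ => f (x, y)) _ _)
  have hcont : Continuous fun x : ℝ => ∫ y in (0 : ℝ)..(2 * Real.pi), f (x, y) :=
    intervalIntegral.continuous_parametric_intervalIntegral_of_continuous'
      (f := fun x y => f (x, y)) hc _ _
  have houter := Complex.reCLM.intervalIntegral_comp_comm
    (hcont.intervalIntegrable (μ := volume) 0 (2 * Real.pi))
  simp only [Complex.reCLM_apply] at houter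
  rw [torusMean]
  simp_rw [hinner]
  rw [houter, h.integral_eq, show (2 * (Real.pi : ℂ)) ^ 2 = (((2 * Real.pi) ^ 2 : ℝ) : ℂ) by
    push_cast; rfl, Complex.re_ofReal_mul, ← mul_assoc, one_div_mul_cancel (by positivity),
    one_mul]

/-! ### Restriction to lines -/

theorem torusExp_line (k : ℝ) (j : ℤ × ℤ) (x y t : ℝ) : torusExp j (x + t, y + k * t)
    = torusExp j (x, y) * Complex.exp (Complex.I * ((freq k j * t : ℝ) : ℂ)) := by
  rw [torusExp, torusExp, ← Complex.exp_add, freq_apply]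
  congr 1
  push_cast
  ring

/-- The phase factors are unimodular and equal `1` at `j = 0`, which is why means along the lines do
not depend on `θ`. -/
theorem HasTorusSeries.translate {b : ℤ × ℤ → ℂ} {f : ℝ × ℝ → ℂ} (h : HasTorusSeries b f)
    (θ : ℝ) : HasTorusSeries (fun j => b j * torusExp j (0, θ)) fun p => f (p.1, θ + p.2) := by
  refine ⟨by simpa [norm_torusExp] using h.summable, fun p => ?_⟩
  refine (h.hasSum _).congr_fun fun j => ?_
  rw [mul_assoc]
  congr 1
  rw [torusExp, torusExp, torusExp, ← Complex.exp_add]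
  congr 1
  push_cast
  ring

theorem HasTorusSeries.hasP0 {b : ℤ × ℤ → ℂ} {f : ℝ × ℝ → ℂ} (h : HasTorusSeries b f)
    (k θ : ℝ) : HasP0 k (fun α => (f (α, θ + k * α)).re) (b 0).re := by
  have ht := h.translate θ
  refine ⟨fun p => (f (p.1, θ + p.2)).re, Complex.continuous_re.comp ht.continuous,
    ht.isTorusFunction_re, fun α => rfl, ?_⟩
  rw [ht.torusMean_re, torusExp_zero, mul_one]

theorem HasTorusSeries.hasTrigSeries {b : ℤ × ℤ → ℂ} {f : ℝ × ℝ → ℂ} (h : HasTorusSeries b f)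
    (k θ : ℝ) : HasTrigSeries (fun j => b j * torusExp j (0, θ)) (freq k)
      fun α => f (α, θ + k * α) := by
  refine ⟨by simpa [norm_torusExp] using h.summable, fun α => ?_⟩
  refine (h.hasSum _).congr_fun fun j => ?_
  rw [mul_assoc, ← torusExp_line, zero_add]

/-- The Hilbert transform on the line of a quasi-periodic function is given by the multiplier
`-i sgn(j₁ + j₂ k)`. -/
theorem HasTorusSeries.hasHilbert {k : ℝ} {b : ℤ × ℤ → ℂ} {f g : ℝ × ℝ → ℂ}
    (hf : HasTorusSeries b f)
    (hg : HasTorusSeries (fun j => (-Complex.I) * ((SignType.sign (freq k j) : ℝ) : ℂ) * b j) g)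
    (θ : ℝ) : HasHilbert (fun α => (f (α, θ + k * α)).re) fun α => (g (α, θ + k * α)).re := by
  refine (hf.hasTrigSeries k θ).hasHilbert ?_
  convert hg.hasTrigSeries k θ using 2
  ring

/-! ### Real functions with rapidly convergent Fourier series -/

/-- `U` is a real function on the torus whose Fourier series `∑ⱼ bⱼ e^{i ⟨j, α⟩}` converges
absolutely, together with its derivatives of all orders along `(1, k)`. -/
structure TorusRep (k : ℝ) (U : ℝ × ℝ → ℝ) (b : ℤ × ℤ → ℂ) : Prop where
  summable_pow : ∀ n : ℕ, Summable fun j => ‖b j‖ * |freq k j| ^ n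
  symm : ∀ j, b (-j) = (starRingEnd ℂ) (b j)
  hasSum : ∀ p, HasSum (fun j => b j * torusExp j p) (U p : ℂ)

namespace TorusRep

variable {k : ℝ} {U V : ℝ × ℝ → ℝ} {b d : ℤ × ℤ → ℂ}

theorem hasTorusSeries (h : TorusRep k U b) : HasTorusSeries b fun p => (U p : ℂ) :=
  ⟨by simpa using h.summable_pow 0, h.hasSum⟩

theorem torusCoeff_eq (h : TorusRep k U b) (j : ℤ × ℤ) : torusCoeff U j = b j :=
  h.hasTorusSeries.fourier_integral j

/-- The symmetry makes the sum its own conjugate, so taking the real part discards nothing. -/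
theorem of_symm (hs : ∀ n : ℕ, Summable fun j => ‖b j‖ * |freq k j| ^ n)
    (hb : ∀ j, b (-j) = (starRingEnd ℂ) (b j)) :
    TorusRep k (fun p => (∑' j, b j * torusExp j p).re) b := by
  refine ⟨hs, hb, fun p => ?_⟩
  have h := (HasTorusSeries.tsum (by simpa using hs 0)).hasSum p
  have hconj : (starRingEnd ℂ) (∑' j, b j * torusExp j p) = ∑' j, b j * torusExp j p := by
    refine HasSum.unique (Complex.hasSum_conj.1 ?_) h
    refine ((Equiv.neg _).hasSum_iff.2 h).congr_fun fun j => ?_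
    simp only [Function.comp, Equiv.neg_apply, map_mul, hb]
    congr 1
    rw [torusExp, torusExp, ← Complex.exp_conj]
    congr 1
    simp
    ring
  rw [Complex.conj_eq_iff_re.1 hconj]
  exact h

theorem hilbert (h : TorusRep k U b) : TorusRep k (torusHilbert k U)
    fun j => (-Complex.I) * ((SignType.sign (freq k j) : ℝ) : ℂ) * b j := by
  have hU : torusHilbert k U = fun p => (∑' j, (-Complex.I) *
      ((SignType.sign (freq k j) : ℝ) : ℂ) * b j * torusExp j p).re := by
    funext p
    simp only [torusHilbert, h.torusCoeff_eq, freq_apply]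
  rw [hU]
  refine of_symm (fun n => ?_) fun j => ?_
  · refine (h.summable_pow n).of_nonneg_of_le (fun j => by positivity) fun j => ?_
    refine mul_le_mul_of_nonneg_right ?_ (by positivity)
    rw [norm_mul, norm_mul, norm_neg, Complex.norm_I, one_mul, Complex.norm_real]
    refine mul_le_of_le_one_left (norm_nonneg _) ?_
    cases SignType.sign (freq k j) <;> simp
  · rw [map_neg, Left.sign_neg, h.symm]
    simp

theorem hasDerivAt_aux (h : TorusRep k U b) (x y t : ℝ) :
    HasDerivAt (fun t : ℝ => (U (x + t, y + k * t) : ℂ))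
      (∑' j, Complex.I * (freq k j : ℂ) * b j * torusExp j (x + t, y + k * t)) t := by
  have hU : (fun t : ℝ => (U (x + t, y + k * t) : ℂ))
      = fun t : ℝ => ∑' j, b j * torusExp j (x + t, y + k * t) :=
    funext fun t => (h.hasSum _).tsum_eq.symm
  rw [hU]
  refine hasDerivAt_tsum (u := fun j => ‖b j‖ * |freq k j| ^ 1) (y₀ := 0)
    (g := fun j (t : ℝ) => b j * torusExp j (x + t, y + k * t))
    (g' := fun j (t : ℝ) => Complex.I * (freq k j : ℂ) * b j * torusExp j (x + t, y + k * t))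
    (h.summable_pow 1) (fun j t => ?_) (fun j t => ?_) (h.hasSum (x + 0, y + k * 0)).summable t
  · simp only [torusExp_line]
    have h0 : HasDerivAt (fun t : ℝ => ((freq k j * t : ℝ) : ℂ)) ((freq k j * 1 : ℝ) : ℂ) t :=
      ((hasDerivAt_id t).const_mul (freq k j)).ofReal_comp
    have h1 : HasDerivAt (fun t : ℝ => Complex.exp (Complex.I * ((freq k j * t : ℝ) : ℂ)))
        (Complex.exp (Complex.I * ((freq k j * t : ℝ) : ℂ)) *
          (Complex.I * ((freq k j * 1 : ℝ) : ℂ))) t := (h0.const_mul Complex.I).cexp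
    have h2 := (h1.const_mul (torusExp j (x, y))).const_mul (b j)
    refine h2.congr_deriv ?_
    rw [mul_one]
    ring
  · rw [norm_mul, norm_mul, norm_mul, norm_torusExp, Complex.norm_I, Complex.norm_real,
      Real.norm_eq_abs]
    exact le_of_eq (by ring)

theorem torusD_eq (h : TorusRep k U b) (p : ℝ × ℝ) :
    torusD k U p = (∑' j, Complex.I * (freq k j : ℂ) * b j * torusExp j p).re := by
  obtain ⟨x, y⟩ := p
  have h1 := Complex.reCLM.hasFDerivAt.comp_hasDerivAt 0 (h.hasDerivAt_aux x y 0)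
  simp only [add_zero, mul_zero, Complex.reCLM_apply] at h1
  rw [← h1.deriv, torusD, lineDeriv]
  congr 1
  funext t
  simp only [Function.comp, Complex.reCLM_apply, Complex.ofReal_re, Prod.smul_mk, smul_eq_mul,
    mul_one, Prod.mk_add_mk, mul_comm t k]

theorem torusD (h : TorusRep k U b) :
    TorusRep k (torusD k U) fun j => Complex.I * (freq k j : ℂ) * b j := by
  have hU : QPWave.torusD k U = _ := funext h.torusD_eq
  rw [hU]
  refine of_symm (fun n => ?_) fun j => ?_
  · refine (h.summable_pow (n + 1)).congr fun j => ?_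
    rw [norm_mul, norm_mul, Complex.norm_I, Complex.norm_real, Real.norm_eq_abs]
    ring
  · rw [map_neg, h.symm]
    simp

theorem hasDerivAt_line (h : TorusRep k U b) (θ α : ℝ) :
    HasDerivAt (fun α => U (α, θ + k * α)) (QPWave.torusD k U (α, θ + k * α)) α := by
  have h1 := Complex.reCLM.hasFDerivAt.comp_hasDerivAt α (h.hasDerivAt_aux 0 θ α)
  simp only [zero_add, Complex.reCLM_apply] at h1
  rw [h.torusD_eq]
  exact h1

/-- Differentiation along `(1, k)` stays within the class, so the induction runs over all functions
of the class at once. -/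
theorem contDiff_line (h : TorusRep k U b) (θ : ℝ) :
    ContDiff ℝ ∞ fun α => U (α, θ + k * α) := by
  rw [contDiff_infty]
  intro n
  induction n generalizing U b with
  | zero =>
    exact contDiff_zero.2 (continuous_iff_continuousAt.2 fun α => (h.hasDerivAt_line θ α).continuousAt)
  | succ n ih =>
    rw [Nat.cast_add, Nat.cast_one, contDiff_succ_iff_deriv]
    refine ⟨fun α => (h.hasDerivAt_line θ α).differentiableAt, by simp, ?_⟩
    rw [funext fun α => (h.hasDerivAt_line θ α).deriv]
    exact ih h.torusD

theorem const_add (h : TorusRep k U b) (z : ℝ) :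
    TorusRep k (fun p => z + U p) fun j => (if j = 0 then (z : ℂ) else 0) + b j := by
  refine ⟨fun n => ?_, fun j => ?_, fun p => ?_⟩
  · have h0 : Summable fun j : ℤ × ℤ => ‖(if j = 0 then (z : ℂ) else 0)‖ * |freq k j| ^ n :=
      summable_of_ne_finset_zero (s := {0}) fun j hj => by
        rw [if_neg (by simpa using hj), norm_zero, zero_mul]
    refine (h0.add (h.summable_pow n)).of_nonneg_of_le (fun j => by positivity) fun j => ?_
    rw [← add_mul]
    exact mul_le_mul_of_nonneg_right (norm_add_le _ _) (by positivity)
  · rw [map_add, h.symm, apply_ite (starRingEnd ℂ), map_zero, Complex.conj_ofReal]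
    simp only [neg_eq_zero]
  · have h0 := hasSum_ite_eq (0 : ℤ × ℤ) (z : ℂ)
    have := h0.add (h.hasSum p)
    rw [← Complex.ofReal_add] at this
    refine this.congr_fun fun j => ?_
    by_cases hj : j = 0
    · subst hj
      simp [torusExp_zero]
    · simp [hj]

theorem const_mul (h : TorusRep k U b) (z : ℝ) :
    TorusRep k (fun p => z * U p) fun j => (z : ℂ) * b j := by
  refine ⟨fun n => ?_, fun j => ?_, fun p => ?_⟩
  · refine ((h.summable_pow n).mul_left ‖(z : ℂ)‖).congr fun j => ?_
    rw [norm_mul, mul_assoc]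
  · rw [map_mul, h.symm, Complex.conj_ofReal]
  · rw [Complex.ofReal_mul]
    refine ((h.hasSum p).mul_left (z : ℂ)).congr_fun fun j => ?_
    rw [mul_assoc]

theorem hasHilbert_line (h : TorusRep k U b) (hV : TorusRep k V
      fun j => (-Complex.I) * ((SignType.sign (freq k j) : ℝ) : ℂ) * b j) (θ : ℝ) :
    HasHilbert (fun α => U (α, θ + k * α)) fun α => V (α, θ + k * α) :=
  h.hasTorusSeries.hasHilbert hV.hasTorusSeries θ

theorem hasP0 (h : TorusRep k U b) (θ : ℝ) :
    HasP0 k (fun α => U (α, θ + k * α)) (b 0).re :=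
  h.hasTorusSeries.hasP0 k θ

end TorusRep

/-! ### Exponentially decaying coefficients -/

theorem summable_exp_neg_mul_abs {s : ℝ} (hs : 0 < s) :
    Summable fun n : ℤ => Real.exp (-(s * |(n : ℝ)|)) := by
  have h : Summable fun n : ℕ => Real.exp (-s) ^ n :=
    summable_geometric_of_lt_one (Real.exp_pos _).le (Real.exp_lt_one_iff.2 (by linarith))
  have h' : Summable fun n : ℕ => Real.exp (-(s * n)) :=
    h.congr fun n => by rw [← Real.exp_nat_mul]; congr 1; ring
  exact Summable.of_nat_of_neg (by simpa using h') (by simpa using h')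

/-- With `M = max(|j₁|, |j₂|)`, one of the three factors `e^{-εKM}` absorbs the power of `|j₁ + j₂
k| ≤ 2KM`. The other two give the summable product `e^{-εK|j₁|} e^{-εK|j₂|}`. -/
theorem summable_mul_freq_pow {k : ℝ} (hk : 0 < k) {a : ℤ × ℤ → ℂ} {C ε : ℝ} (hε : 0 < ε)
    (h : ∀ j : ℤ × ℤ,
      ‖a j‖ ≤ C * Real.exp (-(3 * ε * max k 1 * max |(j.1 : ℝ)| |(j.2 : ℝ)|))) (n : ℕ) :
    Summable fun j => ‖a j‖ * |freq k j| ^ n := by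
  set K := max k 1
  have hK : 1 ≤ K := le_max_right _ _
  have hkK : k ≤ K := le_max_left _ _
  have hC : 0 ≤ C := by
    have := (norm_nonneg _).trans (h 0)
    simpa using this
  have hεK : 0 < ε * K := by positivity
  have hs := (summable_exp_neg_mul_abs hεK).mul_of_nonneg (summable_exp_neg_mul_abs hεK)
    (fun _ => (Real.exp_pos _).le) fun _ => (Real.exp_pos _).le
  refine (hs.mul_left (C * ((2 / ε) ^ n * n.factorial))).of_nonneg_of_le
    (fun j => by positivity) fun j => ?_
  set M := max |(j.1 : ℝ)| |(j.2 : ℝ)| with hMdef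
  have h1 : |(j.1 : ℝ)| ≤ M := le_max_left _ _
  have h2 : |(j.2 : ℝ)| ≤ M := le_max_right _ _
  have hM : 0 ≤ M := (abs_nonneg _).trans h1
  have hfreq : |freq k j| ≤ 2 / ε * (ε * K * M) := by
    have h3 : |freq k j| ≤ |(j.1 : ℝ)| + |(j.2 : ℝ)| * k := by
      rw [freq_apply]
      refine (abs_add_le _ _).trans_eq ?_
      rw [abs_mul, abs_of_pos hk]
    have h4 : |(j.2 : ℝ)| * k ≤ M * K := mul_le_mul h2 hkK hk.le hM
    have h5 : M ≤ M * K := le_mul_of_one_le_right hM hK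
    have h6 : 2 / ε * (ε * K * M) = 2 * (M * K) := by field_simp
    linarith
  have hpow : |freq k j| ^ n ≤ (2 / ε) ^ n * n.factorial * Real.exp (ε * K * M) := by
    refine (pow_le_pow_left₀ (abs_nonneg _) hfreq n).trans ?_
    rw [mul_pow, mul_assoc ((2 / ε) ^ n)]
    have hpos : 0 ≤ ε * K * M := by positivity
    have := Real.pow_div_factorial_le_exp _ hpos n
    rw [div_le_iff₀' (by positivity)] at this
    exact mul_le_mul_of_nonneg_left this (by positivity)
  calc ‖a j‖ * |freq k j| ^ n
      ≤ (C * Real.exp (-(3 * ε * K * M))) *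
        ((2 / ε) ^ n * n.factorial * Real.exp (ε * K * M)) :=
        mul_le_mul (h j) hpow (by positivity) (by positivity)
    _ = C * ((2 / ε) ^ n * n.factorial) * Real.exp (-(2 * (ε * K * M))) := by
        rw [show -(2 * (ε * K * M)) = -(3 * ε * K * M) + ε * K * M by ring, Real.exp_add]
        ring
    _ ≤ C * ((2 / ε) ^ n * n.factorial) *
        (Real.exp (-(ε * K * |(j.1 : ℝ)|)) * Real.exp (-(ε * K * |(j.2 : ℝ)|))) := by
        refine mul_le_mul_of_nonneg_left ?_ (by positivity)
        rw [← Real.exp_add]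
        refine Real.exp_le_exp.2 ?_
        have h3 := mul_le_mul_of_nonneg_left h1 hεK.le
        have h4 := mul_le_mul_of_nonneg_left h2 hεK.le
        linarith

/-! ### Difference quotients of Fourier series -/

/-- The difference quotient `(e^{i x} - 1) / x`, extended continuously to `x = 0`. -/
def expSlope (x : ℝ) : ℂ := dslope (fun x : ℝ => Complex.exp (Complex.I * (x : ℂ))) 0 x

theorem hasDerivAt_exp_I_mul :
    HasDerivAt (fun x : ℝ => Complex.exp (Complex.I * (x : ℂ))) Complex.I 0 := by
  have h := (Complex.ofRealCLM.hasDerivAt (x := (0 : ℝ))).const_mul Complex.I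
  simpa using h.cexp

theorem expSlope_zero : expSlope 0 = Complex.I := by
  rw [expSlope, dslope_same, hasDerivAt_exp_I_mul.deriv]

theorem mul_expSlope (x : ℝ) : (x : ℂ) * expSlope x = Complex.exp (Complex.I * (x : ℂ)) - 1 := by
  have h := sub_smul_dslope (fun x : ℝ => Complex.exp (Complex.I * (x : ℂ))) 0 x
  simpa [expSlope] using h

theorem continuous_expSlope : Continuous expSlope := by
  refine continuous_iff_continuousAt.2 fun x => ?_
  rcases eq_or_ne x 0 with rfl | hx
  · exact continuousAt_dslope_same.2 hasDerivAt_exp_I_mul.differentiableAt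
  · exact (continuousAt_dslope_of_ne hx).2 (by fun_prop)

theorem norm_expSlope_le (x : ℝ) : ‖expSlope x‖ ≤ 1 := by
  rcases eq_or_ne x 0 with rfl | hx
  · rw [expSlope_zero, Complex.norm_I]
  · have h : |x| * ‖expSlope x‖ ≤ |x| := by
      have h1 := Real.norm_exp_I_mul_ofReal_sub_one_le (x := x)
      rw [← mul_expSlope, norm_mul, Complex.norm_real] at h1
      exact h1
    have hx' : 0 < |x| := abs_pos.2 hx
    nlinarith

namespace Wiener

theorem summable_chord {k : ℝ} {b : ℤ × ℤ → ℂ} (hb : Summable fun j => ‖b j‖ * |freq k j|)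
    (r : ℝ) : Summable fun j => ‖b j * ((freq k j : ℂ) * expSlope (freq k j * r))‖ := by
  refine hb.of_nonneg_of_le (fun _ => norm_nonneg _) fun j => ?_
  rw [norm_mul, norm_mul, Complex.norm_real, Real.norm_eq_abs]
  exact mul_le_mul_of_nonneg_left (mul_le_of_le_one_right (abs_nonneg _) (norm_expSlope_le _))
    (norm_nonneg _)

/-- The element of the Wiener algebra that represents the difference quotient
`1 + (f(α + r (1, k)) - f(α)) / r` of `f = ∑ⱼ bⱼ e^{i ⟨j, α⟩}`. -/
def chord {k : ℝ} {b : ℤ × ℤ → ℂ} (hb : Summable fun j => ‖b j‖ * |freq k j|) (r : ℝ) : Wiener :=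
  1 + ofSummable _ (summable_chord hb r)

variable {k : ℝ} {b : ℤ × ℤ → ℂ} (hb : Summable fun j => ‖b j‖ * |freq k j|)

theorem coeff_chord_zero (j : ℤ × ℤ) :
    (chord hb 0).coeff j = (if j = 0 then 1 else 0) + b j * (freq k j * Complex.I) := by
  rw [chord, coeff_add, coeff_one, coeff_ofSummable, mul_zero, expSlope_zero]

/-- Each coefficient is continuous, at `r = 0` too because `expSlope` is, and `2 ‖b j‖ |freq k j|`
dominates the differences. -/
theorem continuous_chord : Continuous (chord hb) := by
  refine continuous_const.add (continuous_iff_continuousAt.2 fun r => ?_)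
  rw [ContinuousAt, tendsto_iff_norm_sub_tendsto_zero]
  simp_rw [norm_eq, coeff_sub, coeff_ofSummable]
  have h0 : ∑' j, ‖b j * ((freq k j : ℂ) * expSlope (freq k j * r)) -
      b j * ((freq k j : ℂ) * expSlope (freq k j * r))‖ = 0 := by simp
  rw [← h0]
  refine tendsto_tsum_of_dominated_convergence (hb.mul_left 2) (fun j => ?_)
    (Eventually.of_forall fun s j => ?_)
  · have hc : Continuous fun s => ‖b j * ((freq k j : ℂ) * expSlope (freq k j * s)) -
        b j * ((freq k j : ℂ) * expSlope (freq k j * r))‖ := by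
      have := continuous_expSlope
      fun_prop
    exact hc.tendsto r
  · rw [norm_norm, ← mul_sub, ← mul_sub, norm_mul, norm_mul, Complex.norm_real, Real.norm_eq_abs,
      ← mul_assoc, mul_comm 2]
    refine mul_le_mul_of_nonneg_left ?_ (by positivity)
    exact (norm_sub_le _ _).trans
      ((add_le_add (norm_expSlope_le _) (norm_expSlope_le _)).trans_eq one_add_one_eq_two)

theorem mul_eval_chord {f : ℝ × ℝ → ℂ} (h : HasTorusSeries b f) (r x y : ℝ) :
    (r : ℂ) * eval (x, y) (chord hb r) = r + (f (x + r, y + k * r) - f (x, y)) := by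
  have h1 := ((ofSummable _ (summable_chord hb r)).hasTorusSeries.hasSum (x, y)).mul_left (r : ℂ)
  have h2 := (h.hasSum (x + r, y + k * r)).sub (h.hasSum (x, y))
  rw [chord, eval_add, eval_one, mul_add, mul_one]
  congr 1
  refine h1.unique (h2.congr_fun fun j => ?_)
  have hs := mul_expSlope (freq k j * r)
  rw [torusExp_line, coeff_ofSummable]
  push_cast at hs ⊢
  linear_combination (b j * torusExp j (x, y)) * hs

/-- The numerator of the difference quotient has Wiener norm at most `2 ∑ ‖b j‖`, so dividing by `r`
sends it to zero. -/
theorem tendsto_chord (hs : Summable fun j => ‖b j‖) : Tendsto (chord hb) atTop (𝓝 1) := by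
  rw [tendsto_iff_norm_sub_tendsto_zero]
  refine squeeze_zero' (g := fun r => (∑' j, ‖b j‖ * 2) / r)
    (Eventually.of_forall fun _ => norm_nonneg _) ?_ (tendsto_const_nhds.div_atTop tendsto_id)
  filter_upwards [eventually_gt_atTop 0] with r hr
  rw [chord, add_sub_cancel_left, norm_eq, le_div_iff₀ hr, ← tsum_mul_right]
  refine ((summable_chord hb r).mul_right r).tsum_le_tsum (fun j => ?_) (hs.mul_right 2)
  have h1 : b j * ((freq k j : ℂ) * expSlope (freq k j * r)) * r
      = b j * (Complex.exp (Complex.I * ((freq k j * r : ℝ) : ℂ)) - 1) := by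
    rw [← mul_expSlope]
    push_cast
    ring
  have h2 : ‖(r : ℂ)‖ = r := by rw [Complex.norm_real, Real.norm_eq_abs, abs_of_pos hr]
  rw [coeff_ofSummable]
  nth_rewrite 2 [← h2]
  rw [← norm_mul, h1, norm_mul]
  refine mul_le_mul_of_nonneg_left ((norm_sub_le _ _).trans ?_) (norm_nonneg _)
  rw [norm_exp_I_mul, norm_one]
  norm_num

/-- If no difference quotient vanishes, then the derivative has a logarithm. -/
theorem hasLog_chord_zero (hs : Summable fun j => ‖b j‖) (h : ∀ r p, eval p (chord hb r) ≠ 0) :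
    HasLog (chord hb 0) := by
  -- A long chord is close to `1` and so is an exponential. The path of units carries this back to
  -- `r = 0`.
  obtain ⟨R, hR⟩ := ((tendsto_chord hb hs).eventually eventually_hasLog).exists
  exact hasLog_of_path (continuous_chord hb) (fun r => isUnit_of_eval_ne_zero (h r)) hR

end Wiener

theorem TorusRep.eq_of_coeff {k : ℝ} {U V : ℝ × ℝ → ℝ} {b : ℤ × ℤ → ℂ} (hU : TorusRep k U b)
    (hV : TorusRep k V b) : U = V :=
  funext fun p => Complex.ofReal_injective ((hU.hasSum p).unique (hV.hasSum p))

theorem TorusRep.isTorusFunction {k : ℝ} {U : ℝ × ℝ → ℝ} {b : ℤ × ℤ → ℂ} (h : TorusRep k U b) :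
    IsTorusFunction U :=
  h.hasTorusSeries.isTorusFunction_re

/-! ### The complex tangent `ξ_α + i η_α` on the torus -/

/-- The periodic part `ξ̃ + i η̃` of the conformal map on the torus, with `ξ̃ = H[η̃]`. -/
def torusZeta (k : ℝ) (η : ℝ × ℝ → ℝ) (p : ℝ × ℝ) : ℂ :=
  (torusHilbert k η p : ℂ) + Complex.I * (η p : ℂ)

/-- The tangent `ξ_α + i η_α` on the torus. -/
def torusTangent (k : ℝ) (η : ℝ × ℝ → ℝ) (p : ℝ × ℝ) : ℂ :=
  (torusXiAlpha k η p : ℂ) + Complex.I * (torusD k η p : ℂ)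

/-- The Fourier coefficients of `ξ̃ + i η̃`. -/
def zetaCoeff (k : ℝ) (a : ℤ × ℤ → ℂ) (j : ℤ × ℤ) : ℂ :=
  (-Complex.I) * ((SignType.sign (freq k j) : ℝ) : ℂ) * a j + Complex.I * a j

/-- At positive frequencies the multiplier `-i` of `H` cancels `i`. This encodes that `ξ̃ + i η̃` is
a boundary value from the lower half-plane. -/
theorem zetaCoeff_eq_zero {k : ℝ} (a : ℤ × ℤ → ℂ) {j : ℤ × ℤ} (hj : 0 < freq k j) :
    zetaCoeff k a j = 0 := by
  simp [zetaCoeff, sign_pos hj]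

section

variable {k : ℝ} {η : ℝ × ℝ → ℝ} {a : ℤ × ℤ → ℂ}

theorem TorusRep.torusZeta (h : TorusRep k η a) : HasTorusSeries (zetaCoeff k a) (torusZeta k η) := by
  have h1 := h.hilbert.hasTorusSeries
  have h2 := h.hasTorusSeries
  refine ⟨(h1.summable.add (h2.summable.mul_left ‖Complex.I‖)).of_nonneg_of_le
    (fun _ => norm_nonneg _) fun j => ?_, fun p => ?_⟩
  · refine (norm_add_le _ _).trans_eq ?_
    rw [norm_mul Complex.I]
  · refine ((h1.hasSum p).add ((h2.hasSum p).mul_left Complex.I)).congr_fun fun j => ?_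
    rw [zetaCoeff]
    ring

theorem TorusRep.summable_zetaCoeff_mul (h : TorusRep k η a) :
    Summable fun j => ‖zetaCoeff k a j‖ * |freq k j| := by
  have h1 := h.hilbert.summable_pow 1
  have h2 := (h.summable_pow 1).mul_left ‖Complex.I‖
  refine (h1.add h2).of_nonneg_of_le (fun _ => by positivity) fun j => ?_
  rw [pow_one, ← mul_assoc, ← add_mul, ← norm_mul Complex.I]
  exact mul_le_mul_of_nonneg_right (norm_add_le _ _) (abs_nonneg _)

theorem TorusRep.torusXiAlpha (h : TorusRep k η a) : TorusRep k (torusXiAlpha k η) fun j =>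
    (if j = 0 then ((1 : ℝ) : ℂ) else 0) + (-Complex.I) * ((SignType.sign (freq k j) : ℝ) : ℂ) *
      (Complex.I * (freq k j : ℂ) * a j) :=
  h.torusD.hilbert.const_add 1

theorem TorusRep.torusD_hilbert (h : TorusRep k η a) (p : ℝ × ℝ) :
    QPWave.torusD k (torusHilbert k η) p = QPWave.torusXiAlpha k η p - 1 := by
  have h1 := h.hilbert.torusD
  have h2 := h.torusD.hilbert
  have hc : (fun j => Complex.I * (freq k j : ℂ) *
      ((-Complex.I) * ((SignType.sign (freq k j) : ℝ) : ℂ) * a j)) = fun j =>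
      (-Complex.I) * ((SignType.sign (freq k j) : ℝ) : ℂ) * (Complex.I * (freq k j : ℂ) * a j) :=
    funext fun j => by ring
  rw [hc] at h1
  rw [h1.eq_of_coeff h2, QPWave.torusXiAlpha]
  ring

theorem TorusRep.eval_chord_zero (h : TorusRep k η a) (p : ℝ × ℝ) :
    Wiener.eval p (Wiener.chord h.summable_zetaCoeff_mul 0) = torusTangent k η p := by
  refine HasSum.tsum_eq ?_
  refine ((h.torusXiAlpha.hasSum p).add
    ((h.torusD.hasSum p).mul_left Complex.I)).congr_fun fun j => ?_
  rw [Wiener.coeff_chord_zero, zetaCoeff, Complex.ofReal_one]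
  ring

theorem TorusRep.hasDerivAt_zetaZero (h : TorusRep k η a) (θ α : ℝ) :
    HasDerivAt (zetaZero k η θ) (torusTangent k η (α, θ + k * α)) α := by
  have h1 := ((hasDerivAt_id α).add (h.hilbert.hasDerivAt_line θ α)).ofReal_comp
  have h2 := ((h.hasDerivAt_line θ α).ofReal_comp).const_mul Complex.I
  refine (h1.add h2).congr_deriv ?_
  rw [h.torusD_hilbert, torusTangent, add_sub_cancel]

/-- Modulo periods, every torus point lies on a line `(α, θ + k α)` with `θ ∈ [0, 2π)`. There `r`
times the chord is `ζ₀(x + r; θ) - ζ₀(x; θ)`, nonzero for `r ≠ 0` by injectivity. At `r = 0` the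
chord is the tangent. -/
theorem TorusRep.eval_chord_ne_zero (h : TorusRep k η a)
    (h_inj : ∀ θ ∈ Set.Ico 0 (2 * Real.pi), Function.Injective (zetaZero k η θ))
    (h_deriv : ∀ θ ∈ Set.Ico 0 (2 * Real.pi), ∀ α : ℝ, deriv (zetaZero k η θ) α ≠ 0)
    (r : ℝ) (p : ℝ × ℝ) :
    Wiener.eval p (Wiener.chord h.summable_zetaCoeff_mul r) ≠ 0 := by
  obtain ⟨x, y⟩ := p
  set θ := toIcoMod Real.two_pi_pos 0 (y - k * x) with hθ
  have hmem : θ ∈ Set.Ico 0 (2 * Real.pi) := by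
    have := toIcoMod_mem_Ico Real.two_pi_pos 0 (y - k * x)
    rwa [zero_add] at this
  obtain ⟨n, hn⟩ : ∃ n : ℤ, y = θ + k * x + n * (2 * Real.pi) := by
    refine ⟨toIcoDiv Real.two_pi_pos 0 (y - k * x), ?_⟩
    have := toIcoMod_add_toIcoDiv_zsmul Real.two_pi_pos 0 (y - k * x)
    rw [zsmul_eq_mul] at this
    rw [hθ]
    linarith
  have hper : ∀ {U : ℝ × ℝ → ℝ}, IsTorusFunction U → ∀ s,
      U (x + s, y + k * s) = U (x + s, θ + k * (x + s)) := by
    intro U hU s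
    have := hU.add_int 0 n (x + s) (θ + k * (x + s))
    rw [Int.cast_zero, zero_mul, add_zero] at this
    rw [← this, hn]
    congr 2
    ring
  have hz : ∀ s, (zetaZero k η θ (x + s)) = ((x + s : ℝ) : ℂ) +
      QPWave.torusZeta k η (x + s, y + k * s) := by
    intro s
    rw [QPWave.torusZeta, hper h.isTorusFunction, hper h.hilbert.isTorusFunction, zetaZero]
    push_cast
    ring
  rcases eq_or_ne r 0 with rfl | hr
  · rw [h.eval_chord_zero]
    have h1 := h_deriv θ hmem x
    rw [(h.hasDerivAt_zetaZero θ x).deriv] at h1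
    have e1 := hper h.torusD.isTorusFunction 0
    have e2 := hper h.torusXiAlpha.isTorusFunction 0
    simp only [add_zero, mul_zero] at e1 e2
    rwa [torusTangent, ← e1, ← e2] at h1
  · intro h0
    have h1 := Wiener.mul_eval_chord h.summable_zetaCoeff_mul h.torusZeta r x y
    rw [h0, mul_zero] at h1
    have h2 : zetaZero k η θ (x + r) = zetaZero k η θ (x + 0) := by
      rw [hz, hz, mul_zero, add_zero, add_zero]
      push_cast
      linear_combination -h1
    exact hr (add_left_cancel (h_inj θ hmem h2))

/-- The reciprocal of the tangent has only nonpositive frequencies. -/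
theorem TorusRep.exists_reciprocal (h : TorusRep k η a) (hk : Irrational k)
    (h_inj : ∀ θ ∈ Set.Ico 0 (2 * Real.pi), Function.Injective (zetaZero k η θ))
    (h_deriv : ∀ θ ∈ Set.Ico 0 (2 * Real.pi), ∀ α : ℝ, deriv (zetaZero k η θ) α ≠ 0) :
    (∀ p, torusTangent k η p ≠ 0) ∧ ∃ d : ℤ × ℤ → ℂ, (∀ j, 0 < freq k j → d j = 0) ∧
      HasTorusSeries d fun p => (torusTangent k η p)⁻¹ := by
  have hne := h.eval_chord_ne_zero h_inj h_deriv
  refine ⟨fun p => by simpa only [h.eval_chord_zero] using hne 0 p, ?_⟩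
  have hlog := Wiener.hasLog_chord_zero h.summable_zetaCoeff_mul h.torusZeta.summable hne
  obtain ⟨d, hd, hmul⟩ := hlog.exists_inverse hk fun j hj => by
    rw [mem_nonposFreq, not_le] at hj
    have hj0 : j ≠ 0 := by
      rintro rfl
      simp at hj
    rw [Wiener.coeff_chord_zero, if_neg hj0, zetaCoeff_eq_zero a hj, zero_mul, add_zero]
  refine ⟨d.coeff, fun j hj => hd j (by rw [mem_nonposFreq]; exact not_le.2 hj), ?_⟩
  have hF : (fun p => (torusTangent k η p)⁻¹) = fun p => Wiener.eval p d := by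
    funext p
    have := congrArg (Wiener.eval p) hmul
    rw [Wiener.eval_mul, h.eval_chord_zero, Wiener.eval_one] at this
    exact (eq_inv_of_mul_eq_one_right this).symm
  rw [hF]
  exact d.hasTorusSeries

end

theorem torusTangent_normSq (k : ℝ) (η : ℝ × ℝ → ℝ) (p : ℝ × ℝ) :
    Complex.normSq (torusTangent k η p) = torusJ k η p := by
  rw [Complex.normSq_apply, torusTangent, torusJ]
  simp
  ring

theorem inv_torusTangent_re (k : ℝ) (η : ℝ × ℝ → ℝ) (p : ℝ × ℝ) :
    ((torusTangent k η p)⁻¹).re = torusXiAlpha k η p / torusJ k η p := by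
  rw [Complex.inv_re, torusTangent_normSq]
  simp [torusTangent]

theorem inv_torusTangent_im (k : ℝ) (η : ℝ × ℝ → ℝ) (p : ℝ × ℝ) :
    ((torusTangent k η p)⁻¹).im = -torusD k η p / torusJ k η p := by
  rw [Complex.inv_im, torusTangent_normSq]
  simp [torusTangent]

/-- The Hilbert transform of `c η_α / J` is `c (P₀[ξ_α / J] - ξ_α / J)`. -/
theorem hasHilbert_chi {k : ℝ} (hk : Irrational k) (c : ℝ) {η : ℝ × ℝ → ℝ} {d : ℤ × ℤ → ℂ}
    (hd : ∀ j, 0 < freq k j → d j = 0)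
    (h : HasTorusSeries d fun p => (torusTangent k η p)⁻¹) (θ : ℝ) :
    HasHilbert (fun α => c * torusD k η (α, θ + k * α) / torusJ k η (α, θ + k * α))
      fun α => c * ((d 0).re - torusXiAlpha k η (α, θ + k * α) / torusJ k η (α, θ + k * α)) := by
  -- The real part of `i c / w` is `c η_α / J`.
  have hf : HasTorusSeries (fun j => Complex.I * c * d j)
      fun p => Complex.I * c * (torusTangent k η p)⁻¹ := by
    refine ⟨(h.summable.mul_left ‖Complex.I * c‖).congr fun j => (norm_mul _ _).symm, fun p => ?_⟩
    refine ((h.hasSum p).mul_left (Complex.I * c)).congr_fun fun j => ?_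
    ring
  -- The multiplier turns `i c d j` into `sgn · c d j`. As positive frequencies are absent, this is
  -- `-c d j` except at `j = 0`, where adding `c d 0` compensates.
  have hcoef : ∀ j, (-Complex.I) * ((SignType.sign (freq k j) : ℝ) : ℂ) * (Complex.I * c * d j)
      = (if j = 0 then c * d 0 else 0) - c * d j := by
    intro j
    rcases lt_trichotomy (freq k j) 0 with hj | hj | hj
    · have hj0 : j ≠ 0 := by rintro rfl; simp at hj
      rw [if_neg hj0, sign_neg hj]
      rw [SignType.coe_neg_one]
      push_cast
      linear_combination (c * d j) * Complex.I_sq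
    · have hj0 := (freq_eq_zero hk).1 hj
      subst hj0
      simp
    · have hj0 : j ≠ 0 := by rintro rfl; simp at hj
      rw [if_neg hj0, hd j hj]
      simp
  have hg : HasTorusSeries
      (fun j => (-Complex.I) * ((SignType.sign (freq k j) : ℝ) : ℂ) * (Complex.I * c * d j))
      fun p => c * d 0 - c * (torusTangent k η p)⁻¹ := by
    refine ⟨?_, fun p => ?_⟩
    · refine hf.summable.of_nonneg_of_le (fun _ => norm_nonneg _) fun j => ?_
      rw [norm_mul, norm_mul, norm_neg, Complex.norm_I, one_mul, Complex.norm_real]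
      refine mul_le_of_le_one_left (norm_nonneg _) ?_
      cases SignType.sign (freq k j) <;> simp
    · have h0 := hasSum_ite_eq (0 : ℤ × ℤ) ((c : ℂ) * d 0)
      refine (h0.sub ((h.hasSum p).mul_left (c : ℂ))).congr_fun fun j => ?_
      rw [hcoef, sub_mul]
      congr 1
      · by_cases hj : j = 0
        · subst hj
          simp [torusExp_zero]
        · simp [hj]
      · ring
  have hH := hf.hasHilbert hg θ
  convert hH using 2 with α α
  · rw [mul_assoc, Complex.I_mul_re, Complex.im_ofReal_mul, inv_torusTangent_im]
    ring
  · rw [Complex.sub_re, Complex.re_ofReal_mul, Complex.re_ofReal_mul, inv_torusTangent_re]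
    ring

/-! ### The traveling wave -/

theorem zetaTrav_re (k c : ℝ) (η : ℝ × ℝ → ℝ) (θ α t : ℝ) :
    (zetaTrav k c η θ α t).re = α + torusHilbert k η (α, θ + k * α) + c * t := by
  simp [zetaTrav, zetaZero]

theorem zetaTrav_im (k c : ℝ) (η : ℝ × ℝ → ℝ) (θ α t : ℝ) :
    (zetaTrav k c η θ α t).im = η (α, θ + k * α) := by
  simp [zetaTrav, zetaZero]

theorem hasP0_const (k z : ℝ) : HasP0 k (fun _ => z) z := by
  refine ⟨fun _ => z, continuous_const, ⟨fun _ _ => rfl, fun _ _ => rfl⟩, fun _ => rfl, ?_⟩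
  have := Real.pi_ne_zero
  simp only [torusMean, intervalIntegral.integral_const, sub_zero, smul_eq_mul]
  field_simp

section

variable {k : ℝ} {η : ℝ × ℝ → ℝ} {a : ℤ × ℤ → ℂ} (c θ : ℝ)

theorem TorusRep.dAlpha_xi (h : TorusRep k η a) : dAlpha (fun α t => (zetaTrav k c η θ α t).re)
    = fun α _ => QPWave.torusXiAlpha k η (α, θ + k * α) := by
  funext α t
  simp only [dAlpha, zetaTrav_re]
  have h1 : HasDerivAt (fun α => α + torusHilbert k η (α, θ + k * α) + c * t) _ α :=
    ((hasDerivAt_id α).add (h.hilbert.hasDerivAt_line θ α)).add_const (c * t)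
  rw [h1.deriv, h.torusD_hilbert, add_sub_cancel]

theorem TorusRep.dAlpha_line (h : TorusRep k η a) : dAlpha (fun α _ => η (α, θ + k * α))
    = fun α _ => QPWave.torusD k η (α, θ + k * α) := by
  funext α t
  exact (h.hasDerivAt_line θ α).deriv

theorem TorusRep.dAlpha_eta (h : TorusRep k η a) : dAlpha (fun α t => (zetaTrav k c η θ α t).im)
    = fun α _ => QPWave.torusD k η (α, θ + k * α) := by
  simp only [zetaTrav_im]
  exact h.dAlpha_line θ

theorem TorusRep.dAlpha_phi (h : TorusRep k η a) : dAlpha (phiTrav k c η θ)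
    = fun α _ => c * (QPWave.torusXiAlpha k η (α, θ + k * α) - 1) := by
  funext α t
  simp only [dAlpha, phiTrav, phiZero]
  rw [((h.hilbert.hasDerivAt_line θ α).const_mul c).deriv, h.torusD_hilbert]

theorem TorusRep.jac_eq (h : TorusRep k η a) : jac (fun α t => (zetaTrav k c η θ α t).re)
    (fun α t => (zetaTrav k c η θ α t).im) = fun α _ => torusJ k η (α, θ + k * α) := by
  funext α t
  rw [jac, h.dAlpha_xi, h.dAlpha_eta, torusJ]

theorem TorusRep.kappa_eq (h : TorusRep k η a) : kappa (fun α t => (zetaTrav k c η θ α t).re)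
    (fun α t => (zetaTrav k c η θ α t).im) = fun α _ => torusKappa k η (α, θ + k * α) := by
  funext α t
  rw [kappa, h.jac_eq, h.dAlpha_xi, h.dAlpha_eta, h.torusD.dAlpha_line, h.torusXiAlpha.dAlpha_line,
    torusKappa]

/-- The function `ψ = -H[φ]` of the traveling wave. -/
theorem TorusRep.hasHilbert_phi (h : TorusRep k η a) (hk : Irrational k) :
    HasHilbert (fun α => c * torusHilbert k η (α, θ + k * α))
      fun α => -(-(c * (a 0).re) + c * η (α, θ + k * α)) := by
  have hV := (h.const_mul (-c)).const_add (c * (a 0).re)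
  have h0 : (((a 0).re : ℝ) : ℂ) = a 0 := by
    refine Complex.conj_eq_iff_re.1 ?_
    rw [← h.symm, neg_zero]
  -- This is `H² = -P` on coefficients.
  have hc : (fun j => (if j = 0 then ((c * (a 0).re : ℝ) : ℂ) else 0) + ((-c : ℝ) : ℂ) * a j)
      = fun j => (-Complex.I) * ((SignType.sign (freq k j) : ℝ) : ℂ) *
        ((c : ℂ) * ((-Complex.I) * ((SignType.sign (freq k j) : ℝ) : ℂ) * a j)) := by
    funext j
    by_cases hj : j = 0
    · subst hj
      push_cast
      rw [h0]
      simp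
    · have hs : ((SignType.sign (freq k j) : ℝ) : ℂ) ^ 2 = 1 := by
        rcases lt_or_gt_of_ne (mt (freq_eq_zero hk).1 hj) with hlt | hgt
        · simp [sign_neg hlt]
        · simp [sign_pos hgt]
      rw [if_neg hj]
      push_cast
      linear_combination (-(c * a j * Complex.I ^ 2)) * hs - (c * a j) * Complex.I_sq
  rw [hc] at hV
  convert (h.hilbert.const_mul c).hasHilbert_line hV θ using 2
  ring

theorem TorusRep.solvesConformal (h : TorusRep k η a) (hk : Irrational k) {g τ : ℝ}
    (h_trav : SolvesTorusTraveling k c g τ η) (hne : ∀ p, torusTangent k η p ≠ 0)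
    {d : ℤ × ℤ → ℂ} (hd : ∀ j, 0 < freq k j → d j = 0)
    (hinv : HasTorusSeries d fun p => (torusTangent k η p)⁻¹) :
    SolvesConformal k g τ (fun _ => c * (d 0).re) (zetaTrav k c η θ) (phiTrav k c η θ) := by
  have hJ : ∀ p, torusJ k η p ≠ 0 := fun p => by
    rw [← torusTangent_normSq]
    exact (Complex.normSq_pos.2 (hne p)).ne'
  have hpsi : dAlpha (fun α _ => -(c * (a 0).re) + c * η (α, θ + k * α))
      = fun α _ => c * QPWave.torusD k η (α, θ + k * α) := by
    funext α t
    exact (((h.hasDerivAt_line θ α).const_mul c).const_add _).deriv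
  have hchi : chi (fun α t => (zetaTrav k c η θ α t).re) (fun α t => (zetaTrav k c η θ α t).im)
      (fun α _ => -(c * (a 0).re) + c * η (α, θ + k * α))
      = fun α _ => c * QPWave.torusD k η (α, θ + k * α) / torusJ k η (α, θ + k * α) := by
    funext α t
    rw [chi, hpsi, h.jac_eq]
  set M := torusMean (torusBernoulli k c g τ η) with hM
  have hphi : ∀ α t, phiRhs g τ (fun _ => c * (d 0).re) (fun α t => (zetaTrav k c η θ α t).re)
      (fun α t => (zetaTrav k c η θ α t).im) (phiTrav k c η θ)
      (fun α _ => -(c * (a 0).re) + c * η (α, θ + k * α))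
      (fun α _ => c * ((d 0).re - QPWave.torusXiAlpha k η (α, θ + k * α) /
        torusJ k η (α, θ + k * α))) α t = c ^ 2 / 2 - M := by
    intro α t
    rw [phiRhs, hpsi, h.dAlpha_phi, h.jac_eq, h.kappa_eq, zetaTrav_im]
    have hB := h_trav (α, θ + k * α)
    rw [← hM, torusBernoulli] at hB
    have hJ0 := hJ (α, θ + k * α)
    -- Here `C₁ - H[χ]` has already become `c ξ_α / J`. The numerators combine to `c² (J - 1)` over
    -- `2 J`.
    have key : ((c * QPWave.torusD k η (α, θ + k * α)) ^ 2 -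
        (c * (QPWave.torusXiAlpha k η (α, θ + k * α) - 1)) ^ 2) / (2 * torusJ k η (α, θ + k * α))
        + c * (QPWave.torusXiAlpha k η (α, θ + k * α) - 1) *
          (c * (QPWave.torusXiAlpha k η (α, θ + k * α) / torusJ k η (α, θ + k * α)))
        = c ^ 2 / 2 - c ^ 2 / (2 * torusJ k η (α, θ + k * α)) := by
      field_simp
      rw [torusJ]
      ring
    linear_combination key - hB
  refine ⟨fun t => c * t, fun α _ => -(c * (a 0).re) + c * η (α, θ + k * α),
    fun α _ => c * ((d 0).re - QPWave.torusXiAlpha k η (α, θ + k * α) /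
      torusJ k η (α, θ + k * α)), ?_⟩
  constructor
  · intro t
    simp only [zetaTrav_re]
    exact (contDiff_id.add (h.hilbert.contDiff_line θ)).add contDiff_const
  · intro t
    simp only [zetaTrav_im]
    exact h.contDiff_line θ
  · intro t
    exact contDiff_const.mul (h.hilbert.contDiff_line θ)
  · intro t
    exact contDiff_const.add (contDiff_const.mul (h.contDiff_line θ))
  · intro α t
    rw [h.jac_eq]
    exact hJ _
  · intro t
    simp only [zetaTrav_im]
    obtain ⟨U, hc, hU, hu, -⟩ := h.hasP0 θ
    exact ⟨U, hc, hU, hu⟩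
  · intro t
    -- The mean vanishes because the multiplier has `sgn 0 = 0`.
    simpa [phiTrav, phiZero] using (h.hilbert.const_mul c).hasP0 θ
  · intro t
    simp only [zetaTrav_re, zetaTrav_im]
    convert h.hasHilbert_line h.hilbert θ using 2
    ring
  · intro t
    rw [h.dAlpha_xi, h.dAlpha_eta]
    convert h.torusD.hasHilbert_line h.torusD.hilbert θ using 2
    exact add_sub_cancel_left _ _
  · intro t
    exact h.hasHilbert_phi c θ hk
  · intro t
    rw [hchi]
    exact hasHilbert_chi hk c hd hinv θ
  · intro t
    -- The function to be averaged is `c (ξ_α² + η_α²) / J`, the constant `c`.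
    refine ⟨c, ?_, by simpa using (hasDerivAt_id t).const_mul c⟩
    convert hasP0_const k c using 2 with α
    rw [hchi, h.dAlpha_xi, h.dAlpha_eta]
    have hJ0 := hJ (α, θ + k * α)
    field_simp
    rw [torusJ]
    ring
  · intro α t
    rw [hchi, h.dAlpha_xi, h.dAlpha_eta]
    simp only [zetaTrav_im]
    refine (hasDerivAt_const t _).congr_deriv ?_
    ring
  · intro t
    -- The argument of `P` is constant by the traveling wave equation, so it equals its own mean and
    -- `φ_t = 0`.
    refine ⟨c ^ 2 / 2 - M, ?_, fun α => ?_⟩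
    · convert hasP0_const k (c ^ 2 / 2 - M) using 2 with α
      exact hphi α t
    · rw [hphi, sub_self]
      exact hasDerivAt_const t _

end

end QPWave

end

theorem mainTheorem1 (k c g τ : ℝ) (hk : 0 < k) (hk_irr : Irrational k)
    (η₀ : ℝ × ℝ → ℝ) (a : ℤ × ℤ → ℂ)
    (h_series : ∀ p : ℝ × ℝ, HasSum (fun j => a j * QPWave.torusExp j p) (η₀ p : ℂ))
    (h_symm : ∀ j, a (-j) = (starRingEnd ℂ) (a j))
    (h_decay : ∃ C ε : ℝ, 0 < ε ∧ ∀ j : ℤ × ℤ,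
      ‖a j‖ ≤ C * Real.exp (-(3 * ε * max k 1 * max |(j.1 : ℝ)| |(j.2 : ℝ)|)))
    (h_trav : QPWave.SolvesTorusTraveling k c g τ η₀)
    (h_inj : ∀ θ ∈ Set.Ico 0 (2 * Real.pi), Function.Injective (QPWave.zetaZero k η₀ θ))
    (h_deriv : ∀ θ ∈ Set.Ico 0 (2 * Real.pi), ∀ α : ℝ, deriv (QPWave.zetaZero k η₀ θ) α ≠ 0) :
    ∃ m : ℝ, ∀ θ : ℝ,
      (∀ t : ℝ, QPWave.HasP0 k (fun α =>
        QPWave.dAlpha (fun a s => (QPWave.zetaTrav k c η₀ θ a s).re) α t /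
          QPWave.jac (fun a s => (QPWave.zetaTrav k c η₀ θ a s).re)
            (fun a s => (QPWave.zetaTrav k c η₀ θ a s).im) α t) m) ∧
      QPWave.SolvesConformal k g τ (fun _ => c * m)
        (QPWave.zetaTrav k c η₀ θ) (QPWave.phiTrav k c η₀ θ) := by
  obtain ⟨C, ε, hε, hC⟩ := h_decay
  have h : QPWave.TorusRep k η₀ a :=
    ⟨QPWave.summable_mul_freq_pow hk hε hC, h_symm, h_series⟩
  obtain ⟨hne, d, hd, hinv⟩ := h.exists_reciprocal hk_irr h_inj h_deriv
  -- `ξ_α / J` is the real part of `1/w`, so its mean is the real part of the zeroth coefficient,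
  -- the same for every `θ` and `t`.
  refine ⟨(d 0).re, fun θ => ⟨fun t => ?_, h.solvesConformal c θ hk_irr h_trav hne hd hinv⟩⟩
  rw [h.dAlpha_xi, h.jac_eq]
  simp only [← QPWave.inv_torusTangent_re]
  exact hinv.hasP0 k θ
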